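/- Let $\mathbb K$ be an algebraically closed field of characteristic zero and let $V$ be a $\mathbb K$-vector space of finite positive dimension. **Bidiagonal pairs.** An ordered pair of linear maps $A,A^*:V\to V$ is a *bidiagonal pair* if (1) $A$ and $A^*$ are diagonalizable; (2) there are orderings $V_0,\dots,V_d$ of the eigenspaces of $A$ and $V^*_0,\dots,V^*_\delta$ of the eigenspaces of $A^*$ with $A^*V_i\subseteq V_i+V_{i+1}$ for $0\le i\le d$ and $AV^*_i\subseteq V^*_i+V^*_{i+1}$ for $0\le i\le\delta$, where $V_{d+1}=0=V^*_{\delta+1}$; (3) with $[A,A^*]=AA^*-A^*A$, the maps $[A,A^*]^{\delta-2i}:V_i^*\to V^*_{\delta-i}$ $(0\le i\le\delta/2)$ and $[A,A^*]^{d-2i}:V_i\to V_{d-i}$ $(0\le i\le d/2)$ are bijections. Then $d=\delta$ (the *diameter*), the orderings in (2) are unique, and the corresponding sequences of eigenvalues of $A$ and of $A^*$ are the *eigenvalue sequence* and the *dual eigenvalue sequence*. For $d\ge 2$ the *base* of the pair is the unique nonzero $b\in\mathbb K$ for which $AA^*-bA^*A-\alpha A-\alpha^*A^*-\gamma I=0$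 for some $\alpha,\alpha^*,\gamma\in\mathbb K$; for $d\le 1$ the base is $1$ by convention. The pair is *reduced* if either $b=1$ and its eigenvalue and dual eigenvalue sequences are $\{2i-d\}_{i=0}^d$ and $\{d-2i\}_{i=0}^d$, or $b\ne1$ and, for some $q\in\mathbb K$ with $b=q^{-2}$, they are $\{q^{d-2i}\}_{i=0}^d$ and $\{q^{2i-d}\}_{i=0}^d$. **$\mathfrak{sl}_2$.** Let $\mathfrak{sl}_2$ be the Lie algebra over $\mathbb K$ with its standard basis $h,e,f$. A basis $X,Y,Z$ of $\mathfrak{sl}_2$ is *equitable* if $[X,Y]=2X+2Y$, $[Y,Z]=2Y+2Z$, $[Z,X]=2Z+2X$; a pair $Y,Z$ is *equitable* if it extends to an equitable basis $X,Y,Z$. An $\mathfrak{sl}_2$-module is *segregated* if it is spanned by eigenvectors of $h$ with even integer eigenvalues, or by eigenvectors of $h$ with odd integer eigenvalues. **$U_q(\mathfrak{sl}_2)$.** For nonzero $q\in\mathbb K$, not a root of unity, let $U_q(\mathfrak{sl}_2)$ be the unital associative $\mathbb K$-algebra with generators $k^{\pm1},e,f$ and relations $kk^{-1}=k^{-1}k=1$,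 $ke=q^2ek$, $kf=q^{-2}fk$, $ef-fe=\frac{k-k^{-1}}{q-q^{-1}}$. Elements $x,x^{-1},y,z$ of it are *equitable generators* if they present it with the relations $xx^{-1}=x^{-1}x=1$, $\frac{qxy-q^{-1}yx}{q-q^{-1}}=\frac{qyz-q^{-1}zy}{q-q^{-1}}=\frac{qzx-q^{-1}xz}{q-q^{-1}}=1$, that is, if the algebra defined by these generators and relations maps isomorphically onto $U_q(\mathfrak{sl}_2)$. (For example $x^{\pm1}=k^{\pm1}$, $y=k^{-1}+(q-q^{-1})f$, $z=k^{-1}-q(q-q^{-1})k^{-1}e$.) A pair $y,z$ is *equitable* if it extends to equitable generators $x,x^{-1},y,z$. A $U_q(\mathfrak{sl}_2)$-module is *segregated* if it is spanned by eigenvectors of $k$ with eigenvalues $q^i$, $i$ an even integer, or by eigenvectors of $k$ with eigenvalues $q^i$, $i$ an odd integer. **Theorem.** Let $A,A^*$ be a reduced bidiagonal pair on $V$ with base $b$. (i) Suppose $b=1$. Then there is a linear map $B:V\to V$ (depending only on $A,A^*$) such that for every equitable pair $Y,Z$ in $\mathfrak{sl}_2$: there is an $\mathfrak{sl}_2$-module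 structure on $V$ in which $Y$ acts as $A$ and $Z$ acts as $A^*$; and in every such module structure, every $X$ for which $X,Y,Z$ is an equitable basis acts as $B$, and the module is segregated. (ii) Suppose $b\ne1$. Let $q\in\mathbb K$ be nonzero, not a root of unity, with $b=q^{-2}$ and such that the eigenvalue and dual eigenvalue sequences of $A,A^*$ are $\{q^{d-2i}\}_{i=0}^d$ and $\{q^{2i-d}\}_{i=0}^d$. Then there are linear maps $B,B':V\to V$ (depending only on $A,A^*,q$) such that for every equitable pair $y,z$ in $U_q(\mathfrak{sl}_2)$: there is a $U_q(\mathfrak{sl}_2)$-module structure on $V$ in which $y$ acts as $A$ and $z$ acts as $A^*$; and in every such module structure, for all $x,x^{-1}$ such that $x,x^{-1},y,z$ are equitable generators, $x$ acts as $B$ and $x^{-1}$ acts as $B'$, and if $x=k$ then the module is segregated. -/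

import Mathlib

noncomputable section

namespace BidiagonalPair

/-! ### Bidiagonal pairs -/

section Pairs

variable {K V : Type*} [Field K] [AddCommGroup V] [Module K V]

/-- `T` is diagonalizable: `V` is spanned by eigenvectors of `T`. -/
def IsDiagonalizable (T : Module.End K V) : Prop :=
  ⨆ μ : K, T.eigenspace μ = ⊤

/-- `θ 0, …, θ d` lists the eigenvalues of `T`, each exactly once; equivalently the eigenspaces
of `θ 0, …, θ d` are an ordering of the eigenspaces of `T`. Values `θ i` with `i > d` play no
role. -/
def IsEigenvalueOrdering (T : Module.End K V) (d : ℕ) (θ : ℕ → K) : Prop :=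
  Set.InjOn θ (Set.Iic d) ∧ θ '' Set.Iic d = {μ : K | T.HasEigenvalue μ}

/-- The `i`-th eigenspace in the ordering given by `θ 0, …, θ d`, with the convention that it
is `0` for `i > d`. -/
def orderedEigenspace (T : Module.End K V) (d : ℕ) (θ : ℕ → K) (i : ℕ) : Submodule K V :=
  if i ≤ d then T.eigenspace (θ i) else ⊥

/-- The ordering `V_0, …, V_d` of the eigenspaces of `A` given by `θ 0, …, θ d` is standard with
respect to `As`: one has `As V_i ⊆ V_i + V_{i+1}` for `0 ≤ i ≤ d`, where `V_{d+1} = 0`.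
For a bidiagonal pair `A, As` this says that `θ 0, …, θ d` is the eigenvalue sequence; with the
roles of `A` and `As` exchanged it gives the dual eigenvalue sequence. -/
def IsEigenvalueSequence (A As : Module.End K V) (d : ℕ) (θ : ℕ → K) : Prop :=
  IsEigenvalueOrdering A d θ ∧
    ∀ i ≤ d, (orderedEigenspace A d θ i).map As ≤
      orderedEigenspace A d θ i ⊔ orderedEigenspace A d θ (i + 1)

/-- `C ^ (d - 2 i)` restricts to a bijection from the `i`-th to the `(d - i)`-th eigenspace of `T`
for `0 ≤ i ≤ d / 2`. -/
def HasBijections (C T : Module.End K V) (d : ℕ) (θ : ℕ → K) : Prop :=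
  ∀ i : ℕ, 2 * i ≤ d →
    Set.BijOn (C ^ (d - 2 * i)) (orderedEigenspace T d θ i : Set V)
      (orderedEigenspace T d θ (d - i) : Set V)

/-- `A, As` is a bidiagonal pair on `V` (for `V` of finite positive dimension). -/
def IsBidiagonalPair (A As : Module.End K V) : Prop :=
  IsDiagonalizable A ∧ IsDiagonalizable As ∧
    ∃ (d δ : ℕ) (θ θs : ℕ → K),
      IsEigenvalueSequence A As d θ ∧ IsEigenvalueSequence As A δ θs ∧
      HasBijections (A * As - As * A) As δ θs ∧ HasBijections (A * As - As * A) A d θ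

/-- The diameter `d` of the pair: `A` has `d + 1` distinct eigenvalues. -/
def diameter (A : Module.End K V) : ℕ :=
  {μ : K | A.HasEigenvalue μ}.ncard - 1

/-- The fundamental bidiagonal relation with leading scalar `b`. -/
def FundamentalRelation (A As : Module.End K V) (b : K) : Prop :=
  ∃ α αs γ : K, A * As - b • (As * A) - α • A - αs • As - γ • (1 : Module.End K V) = 0

open Classical in
/-- The base of a bidiagonal pair `A, As`: the nonzero scalar `b` of the fundamental bidiagonal
relation if the diameter is at least `2` (there it exists and is unique; an arbitrary value is
taken for pairs of maps without such a scalar), and `1` by convention if the diameter is at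
most `1`. -/
def base (A As : Module.End K V) : K :=
  if diameter A ≤ 1 then 1
  else Classical.epsilon fun b : K => b ≠ 0 ∧ FundamentalRelation A As b

/-- Reduced of the first kind: the base is `1`, the eigenvalue sequence is `2 i - d` and the dual
eigenvalue sequence is `d - 2 i`, for `0 ≤ i ≤ d`, with `d` the diameter. -/
def IsReducedOne (A As : Module.End K V) : Prop :=
  base A As = 1 ∧
    IsEigenvalueSequence A As (diameter A) (fun i => 2 * (i : K) - (diameter A : K)) ∧
    IsEigenvalueSequence As A (diameter A) (fun i => (diameter A : K) - 2 * (i : K))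

/-- Reduced of the second kind with parameter `q`: the base is `b = q⁻² ≠ 1`, the eigenvalue
sequence is `q ^ (d - 2 i)` and the dual eigenvalue sequence is `q ^ (2 i - d)`, for
`0 ≤ i ≤ d`, with `d` the diameter. -/
def IsReducedWith (A As : Module.End K V) (q : K) : Prop :=
  base A As ≠ 1 ∧ q ≠ 0 ∧ base A As = (q ^ 2)⁻¹ ∧
    IsEigenvalueSequence A As (diameter A) (fun i => q ^ ((diameter A : ℤ) - 2 * (i : ℤ))) ∧
    IsEigenvalueSequence As A (diameter A) (fun i => q ^ (2 * (i : ℤ) - (diameter A : ℤ)))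

/-- A bidiagonal pair is reduced if it is reduced of the first kind, or of the second kind for a
square root `q` of the inverse of its base. -/
def IsReduced (A As : Module.End K V) : Prop :=
  IsReducedOne A As ∨ ∃ q : K, IsReducedWith A As q

end Pairs

/-! ### The Lie algebra `sl₂` -/

section LieSl2

variable (K : Type*) [Field K]

/-- The Lie algebra `sl₂` over `K`, as the traceless `2 × 2` matrices. -/
abbrev Sl2 := LieAlgebra.SpecialLinear.sl (Fin 2) K

/-- The element `h` of the standard basis `h, e, f` of `sl₂`. -/
def sl2H : Sl2 K :=
  ⟨!![1, 0; 0, -1], by simp [LieAlgebra.SpecialLinear.sl, Matrix.trace_fin_two]⟩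

variable {K}

/-- `X, Y, Z` is an equitable basis of `sl₂`. -/
structure IsEquitableBasis (X Y Z : Sl2 K) : Prop where
  linearIndependent : LinearIndependent K ![X, Y, Z]
  span_eq_top : Submodule.span K {X, Y, Z} = ⊤
  lie_X_Y : ⁅X, Y⁆ = (2 : K) • X + (2 : K) • Y
  lie_Y_Z : ⁅Y, Z⁆ = (2 : K) • Y + (2 : K) • Z
  lie_Z_X : ⁅Z, X⁆ = (2 : K) • Z + (2 : K) • X

/-- The ordered pair `Y, Z` of elements of `sl₂` is equitable. -/
def IsEquitablePair (Y Z : Sl2 K) : Prop :=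
  ∃ X : Sl2 K, IsEquitableBasis X Y Z

variable (K) in
/-- The `sl₂`-module `V` is segregated: it is spanned by eigenvectors of `h` whose eigenvalues are
even integers, or it is spanned by eigenvectors of `h` whose eigenvalues are odd integers. -/
def IsSl2Segregated (V : Type*) [AddCommGroup V] [Module K V] [LieRingModule (Sl2 K) V] : Prop :=
  Submodule.span K {v : V | ∃ i : ℤ, Even i ∧ ⁅sl2H K, v⁆ = (i : K) • v} = ⊤ ∨
  Submodule.span K {v : V | ∃ i : ℤ, Odd i ∧ ⁅sl2H K, v⁆ = (i : K) • v} = ⊤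

end LieSl2

/-! ### The quantum group `U_q(sl₂)` -/

section QuantumSl2

/-- Names of the generators `k, k⁻¹, e, f`. -/
inductive UqGen
  | k | kinv | e | f

/-- Names of the generators `x, x⁻¹, y, z` of the equitable presentation. -/
inductive EqGen
  | x | xinv | y | z

variable (K : Type*) [Field K] (q : K)

open FreeAlgebra in
/-- The defining relations of `U_q(sl₂)`. -/
inductive UqRel : FreeAlgebra K UqGen → FreeAlgebra K UqGen → Prop
  | k_kinv : UqRel (ι K .k * ι K .kinv) 1
  | kinv_k : UqRel (ι K .kinv * ι K .k) 1
  | k_e : UqRel (ι K .k * ι K .e) (q ^ 2 • (ι K .e * ι K .k))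
  | k_f : UqRel (ι K .k * ι K .f) ((q ^ 2)⁻¹ • (ι K .f * ι K .k))
  | e_f : UqRel (ι K .e * ι K .f - ι K .f * ι K .e) ((q - q⁻¹)⁻¹ • (ι K .k - ι K .kinv))

/-- The algebra `U_q(sl₂)` over `K`. -/
abbrev Uq := RingQuot (UqRel K q)

/-- The element `k` of `U_q(sl₂)`. -/
def uqK : Uq K q := RingQuot.mkAlgHom K (UqRel K q) (FreeAlgebra.ι K .k)

open FreeAlgebra in
/-- The relations of the equitable presentation. -/
inductive EqRel : FreeAlgebra K EqGen → FreeAlgebra K EqGen → Prop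
  | x_xinv : EqRel (ι K .x * ι K .xinv) 1
  | xinv_x : EqRel (ι K .xinv * ι K .x) 1
  | x_y : EqRel ((q - q⁻¹)⁻¹ • (q • (ι K .x * ι K .y) - q⁻¹ • (ι K .y * ι K .x))) 1
  | y_z : EqRel ((q - q⁻¹)⁻¹ • (q • (ι K .y * ι K .z) - q⁻¹ • (ι K .z * ι K .y))) 1
  | z_x : EqRel ((q - q⁻¹)⁻¹ • (q • (ι K .z * ι K .x) - q⁻¹ • (ι K .x * ι K .z))) 1

/-- The algebra defined by the equitable presentation. -/
abbrev EqUq := RingQuot (EqRel K q)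

/-- A generator of the algebra defined by the equitable presentation. -/
def eqGen (g : EqGen) : EqUq K q := RingQuot.mkAlgHom K (EqRel K q) (FreeAlgebra.ι K g)

variable {K q}

/-- The elements `x, xinv, y, z` are equitable generators of `U_q(sl₂)`: sending the generators of
the equitable presentation to them gives an isomorphism onto `U_q(sl₂)`. -/
def IsEquitableGenerators (x xinv y z : Uq K q) : Prop :=
  ∃ ψ : EqUq K q ≃ₐ[K] Uq K q,
    ψ (eqGen K q .x) = x ∧ ψ (eqGen K q .xinv) = xinv ∧
    ψ (eqGen K q .y) = y ∧ ψ (eqGen K q .z) = z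

/-- The ordered pair `y, z` of elements of `U_q(sl₂)` is equitable. -/
def IsUqEquitablePair (y z : Uq K q) : Prop :=
  ∃ x xinv : Uq K q, IsEquitableGenerators x xinv y z

variable (K q) in
/-- The `U_q(sl₂)`-module `V` is segregated: it is spanned by eigenvectors of `k` with eigenvalues
`q ^ i`, `i` an even integer, or spanned by eigenvectors of `k` with eigenvalues `q ^ i`, `i` an
odd integer. -/
def IsUqSegregated (V : Type*) [AddCommGroup V] [Module K V] [Module (Uq K q) V] : Prop :=
  Submodule.span K {v : V | ∃ i : ℤ, Even i ∧ uqK K q • v = (q ^ i) • v} = ⊤ ∨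
  Submodule.span K {v : V | ∃ i : ℤ, Odd i ∧ uqK K q • v = (q ^ i) • v} = ⊤

end QuantumSl2

end BidiagonalPair

end

/-! Write `C = [A, A*]`. It sends each eigenspace `V_i` of `A` to `V_{i+1}` and each eigenspace
`V*_i` of `A*` to `V*_{i+1}`, and condition (3) is a hard Lefschetz property of `C` for both
gradings. Such a property makes every homogeneous vector a sum of vectors `C^n u` with `u`
primitive. Hence the decreasing filtration by degree is determined by `C` alone, and the two
gradings share it. So `A*` acts on `V_i` as the scalar `θ*_i` plus `(θ_{i+1} - θ_i)⁻¹ C`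
(`IsBidiagonalPair.exists_isLefschetz`). For reduced eigenvalue sequences this formula already gives
the equitable relation between `A` and `A*`; the fundamental bidiagonal relation is not needed.

The third equitable element must act as `B`, the sum of `-A` (or of `A⁻¹` when `b ≠ 1`) and a map
`L` of degree `-1`; the relations then prescribe `[C, L]` as a scalar `c_i` on each `V_i`, with
`c_{d-i} = -c_i`. Such an `L` exists (`IsLefschetz.exists_lowering`): under the trace form the image
of `ad C` is the orthogonal of the centralizer of `C`, and for `g` in the centralizer the traces of
`g` on `V_i` and `V_{d-i}` agree, so the antisymmetric scalars cancel. `B` is unique because the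
difference of two solutions has degree `-1` and commutes with `C`, which forces it to vanish
(`IsLefschetz.eq_zero_of_commute`).

Segregation comes from the spectrum. Adding a map of degree `1` or `-1` to a diagonal one does not
change the annihilating polynomial with distinct roots. For `sl₂` this carries the eigenvalues of
`Y` to `h` in two such moves, up to sign; in the quantum case it gives the eigenvalues of `B`
itself, and in particular its invertibility. -/

namespace BidiagonalPair

open Finset Polynomial

/-! ### Gradings by eigenspaces and triangular perturbations of diagonalizable maps. -/

section Eigengrading

variable {K V : Type*} [Field K] [AddCommGroup V] [Module K V]

/-- The maps `P i` are the projections of `V` onto the eigenspaces of `T` for `θ 0, …, θ d`, and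
`V` is the sum of these eigenspaces. -/
structure IsEigengrading (T : Module.End K V) (d : ℕ) (θ : ℕ → K)
    (P : ℕ → Module.End K V) : Prop where
  apply_proj : ∀ i v, T (P i v) = θ i • P i v
  proj_of_eigen : ∀ i v, T v = θ i • v → P i v = v
  proj_of_eigen_ne : ∀ i j v, i ≠ j → T v = θ j • v → P i v = 0
  proj_eq_zero : ∀ i, d < i → P i = 0
  sum_proj : ∀ v, ∑ i ∈ range (d + 1), P i v = v

/-- The projections are the Lagrange basis polynomials evaluated at `T`. Injectivity of `θ` on all
of `ℕ` makes a vector with eigenvalue `θ i`, `i > d`, equal to zero, so later statements need no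
bounds on indices. -/
theorem exists_isEigengrading {T : Module.End K V} {d : ℕ} {θ : ℕ → K}
    (hθ : Function.Injective θ) (h : aeval T (Lagrange.nodal (range (d + 1)) θ) = 0) :
    ∃ P, IsEigengrading T d θ P := by
  classical
  have hnod : ∀ v : V, ∀ μ : K, T v = μ • v → (∀ i ∈ range (d + 1), μ ≠ θ i) → v = 0 := by
    intro v μ hv hμ
    have h1 := Module.End.aeval_apply_of_mem_apply_eq_smul
      (p := Lagrange.nodal (range (d + 1)) θ) hv
    rw [h, LinearMap.zero_apply] at h1
    rcases smul_eq_zero.1 h1.symm with h2 | h2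
    · exact absurd h2 (Lagrange.eval_nodal_not_at_node hμ)
    · exact h2
  refine ⟨fun i => if i ≤ d then aeval T (Lagrange.basis (range (d + 1)) θ i) else 0, ?_, ?_, ?_,
    ?_, ?_⟩
  · intro i v
    split_ifs with hi
    · have h1 : (X - C (θ i)) * Lagrange.basis (range (d + 1)) θ i =
          C (Lagrange.nodalWeight (range (d + 1)) θ i) * Lagrange.nodal (range (d + 1)) θ := by
        have hi' : i ∈ range (d + 1) := by simpa [Nat.lt_succ_iff] using hi
        rw [Lagrange.basis_eq_prod_sub_inv_mul_nodal_div hi',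
          ← Lagrange.nodal_erase_eq_nodal_div hi', Lagrange.nodal_eq_mul_nodal_erase hi']
        ring
      have h2 := congrArg (fun p => aeval T p v) h1
      simp only [map_mul, h, map_sub, aeval_X, aeval_C, mul_zero, LinearMap.zero_apply,
        Module.End.mul_apply, LinearMap.sub_apply, Module.algebraMap_end_apply] at h2
      exact sub_eq_zero.1 h2
    · simp
  · intro i v hv
    split_ifs with hi
    · have hi' : i ∈ range (d + 1) := by simpa [Nat.lt_succ_iff] using hi
      rw [Module.End.aeval_apply_of_mem_apply_eq_smul hv,
        Lagrange.eval_basis_self hθ.injOn hi', one_smul]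
    · refine (hnod v (θ i) hv fun j hj hij => hi ?_).symm ▸ by simp
      rw [hθ hij]; simpa [Nat.lt_succ_iff] using hj
  · intro i j v hij hv
    split_ifs with hi
    · by_cases hj : j ∈ range (d + 1)
      · rw [Module.End.aeval_apply_of_mem_apply_eq_smul hv, Lagrange.eval_basis_of_ne hij hj,
          zero_smul]
      · rw [hnod v (θ j) hv fun k hk hjk => hj (hθ hjk ▸ hk), map_zero]
    · simp
  · intro i hi
    simp [not_le.2 hi]
  · intro v
    have h1 := congrArg (fun p => aeval T p v)
      (Lagrange.sum_basis (s := range (d + 1)) (v := θ) hθ.injOn ⟨0, by simp⟩)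
    simp only [map_sum, map_one, Module.End.one_apply, LinearMap.sum_apply] at h1
    rw [← h1]
    refine (sum_congr rfl fun i hi => ?_)
    rw [if_pos (by simpa [Nat.lt_succ_iff] using hi), h1]

theorem aeval_nodal_eq_zero_of_span {T : Module.End K V} {d : ℕ} {θ : ℕ → K}
    (h : Submodule.span K {v : V | ∃ i ≤ d, T v = θ i • v} = ⊤) :
    aeval T (Lagrange.nodal (range (d + 1)) θ) = 0 := by
  refine LinearMap.ext_on h ?_
  rintro v ⟨i, hi, hv⟩
  rw [Module.End.aeval_apply_of_mem_apply_eq_smul hv,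
    Lagrange.eval_nodal_at_node (by simpa [Nat.lt_succ_iff] using hi), zero_smul,
    LinearMap.zero_apply]

namespace IsEigengrading

variable {T : Module.End K V} {d : ℕ} {θ : ℕ → K} {P : ℕ → Module.End K V}

theorem span_eq_top (h : IsEigengrading T d θ P) :
    Submodule.span K {v : V | ∃ i ≤ d, T v = θ i • v} = ⊤ := by
  refine eq_top_iff.2 fun v _ => ?_
  rw [← h.sum_proj v]
  exact Submodule.sum_mem _ fun i hi => Submodule.subset_span
    ⟨i, by simpa [Nat.lt_succ_iff] using hi, h.apply_proj i v⟩

theorem proj_proj (h : IsEigengrading T d θ P) (i : ℕ) (v : V) : P i (P i v) = P i v :=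
  h.proj_of_eigen i _ (h.apply_proj i v)

theorem proj_proj_ne (h : IsEigengrading T d θ P) {i j : ℕ} (hij : i ≠ j) (v : V) :
    P i (P j v) = 0 :=
  h.proj_of_eigen_ne i j _ hij (h.apply_proj j v)

theorem eigen_iff (h : IsEigengrading T d θ P) (i : ℕ) (v : V) : T v = θ i • v ↔ P i v = v :=
  ⟨h.proj_of_eigen i v, fun hv => by rw [← hv]; exact h.apply_proj i v⟩

/-- Induction on vectors through their homogeneous components. -/
theorem ext (h : IsEigengrading T d θ P) {W : Type*} [AddCommGroup W] [Module K W]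
    {f g : V →ₗ[K] W} (hfg : ∀ i ≤ d, ∀ v, P i v = v → f v = g v) : f = g := by
  ext v
  rw [← h.sum_proj v, map_sum, map_sum]
  exact sum_congr rfl fun i hi => hfg i (by simpa [Nat.lt_succ_iff] using hi) _ (h.proj_proj i v)

theorem ext_of_forall_proj (h : IsEigengrading T d θ P) {v w : V}
    (hvw : ∀ i, P i v = P i w) : v = w := by
  rw [← h.sum_proj v, ← h.sum_proj w]
  exact sum_congr rfl fun i _ => hvw i

theorem apply_eq (h : IsEigengrading T d θ P) (i : ℕ) (v : V) : T (P i v) = P i (T v) := by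
  have : T * P i = P i * T := by
    refine h.ext fun j _ v hv => ?_
    have hT := (h.eigen_iff j v).2 hv
    simp only [Module.End.mul_apply, hT, map_smul]
    rcases eq_or_ne i j with rfl | hij
    · rw [hv, hT]
    · rw [h.proj_of_eigen_ne i j v hij hT, map_zero, smul_zero]
  exact LinearMap.congr_fun this v

/-- A map sending each eigenspace into the next one. -/
theorem raise_of_eigen (h : IsEigengrading T d θ P) {N : Module.End K V}
    (hN : ∀ i v, T v = θ i • v → T (N v) = θ (i + 1) • N v) :
    (∀ v, P 0 (N v) = 0) ∧ ∀ i v, P (i + 1) (N v) = N (P i v) := by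
  constructor
  · have : P 0 * N = 0 := h.ext fun j _ v hv => by
      rw [Module.End.mul_apply, LinearMap.zero_apply]
      exact h.proj_of_eigen_ne 0 (j + 1) _ (by omega) (hN j v ((h.eigen_iff j v).2 hv))
    exact fun v => LinearMap.congr_fun this v
  · intro i
    have : P (i + 1) * N = N * P i := h.ext fun j _ v hv => by
      have hT := (h.eigen_iff j v).2 hv
      simp only [Module.End.mul_apply]
      rcases eq_or_ne i j with rfl | hij
      · rw [hv, h.proj_of_eigen _ _ (hN i v hT)]
      · rw [h.proj_of_eigen_ne i j v hij hT, map_zero,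
          h.proj_of_eigen_ne (i + 1) (j + 1) _ (by omega) (hN j v hT)]
    exact fun v => LinearMap.congr_fun this v

/-- A map sending each eigenspace into the previous one. -/
theorem lower_of_eigen (h : IsEigengrading T d θ P) {N : Module.End K V}
    (hN0 : ∀ v, T v = θ 0 • v → N v = 0)
    (hN : ∀ i v, T v = θ (i + 1) • v → T (N v) = θ i • N v) (i : ℕ) (v : V) :
    P i (N v) = N (P (i + 1) v) := by
  have : P i * N = N * P (i + 1) := h.ext fun j _ v hv => by
    have hT := (h.eigen_iff j v).2 hv
    simp only [Module.End.mul_apply]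
    rcases j with _ | j
    · rw [hN0 v hT, map_zero, h.proj_of_eigen_ne (i + 1) 0 v (by omega) hT, map_zero]
    · rcases eq_or_ne i j with rfl | hij
      · rw [hv, h.proj_of_eigen _ _ (hN i v hT)]
      · rw [h.proj_of_eigen_ne (i + 1) (j + 1) v (by omega) hT, map_zero,
          h.proj_of_eigen_ne i j _ hij (hN j v hT)]
  exact LinearMap.congr_fun this v

end IsEigengrading

/-- If `T - μ i` maps the `i`-th term of a finite decreasing filtration into the next term, then
`∏ (T - μ i) = 0`. -/
theorem aeval_nodal_eq_zero_of_filtration {T : Module.End K V} {n : ℕ} {μ : ℕ → K}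
    (W : ℕ → Submodule K V) (h0 : W 0 = ⊤) (hn : W n = ⊥)
    (hW : ∀ i < n, ∀ v ∈ W i, T v - μ i • v ∈ W (i + 1)) :
    aeval T (Lagrange.nodal (range n) μ) = 0 := by
  have key : ∀ m ≤ n, ∀ v, aeval T (Lagrange.nodal (range m) μ) v ∈ W m := by
    intro m
    induction m with
    | zero => intro _ v; simp [h0]
    | succ m ih =>
      intro hm v
      have h1 := hW m (by omega) _ (ih (by omega) v)
      rw [Lagrange.nodal, prod_range_succ, mul_comm, map_mul, Module.End.mul_apply]
      simpa [Module.algebraMap_end_apply, Lagrange.nodal] using h1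
  ext v
  simpa [hn] using key n le_rfl v

namespace IsEigengrading

variable {T : Module.End K V} {d : ℕ} {θ : ℕ → K} {P : ℕ → Module.End K V}

/-- `S` is triangular for the filtration by degrees `≥ i`, with diagonal entries `μ i`, so each `S -
μ i` moves one step down the filtration. -/
theorem aeval_nodal_of_raise (h : IsEigengrading T d θ P) {S N : Module.End K V}
    {μ : ℕ → K} (hS : ∀ i v, P i v = v → S v = μ i • v + N v)
    (hN0 : ∀ v, P 0 (N v) = 0) (hN : ∀ i v, P (i + 1) (N v) = N (P i v)) :
    aeval S (Lagrange.nodal (range (d + 1)) μ) = 0 := by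
  have hPS : ∀ i v, P (i + 1) (S v) = μ (i + 1) • P (i + 1) v + N (P i v) := by
    intro i
    have : P (i + 1) * S = μ (i + 1) • P (i + 1) + N * P i := h.ext fun j _ v hv => by
      simp only [Module.End.mul_apply, hS j v hv, map_add, map_smul, hN, LinearMap.add_apply,
        LinearMap.smul_apply]
      congr 1
      rcases eq_or_ne (i + 1) j with rfl | hij
      · rfl
      · rw [← hv, h.proj_proj_ne hij, smul_zero, smul_zero]
    exact fun v => LinearMap.congr_fun this v
  have hPS0 : ∀ v, P 0 (S v) = μ 0 • P 0 v := by
    have : P 0 * S = μ 0 • P 0 := h.ext fun j _ v hv => by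
      simp only [Module.End.mul_apply, hS j v hv, map_add, map_smul, hN0, LinearMap.smul_apply,
        add_zero]
      rcases eq_or_ne 0 j with rfl | hij
      · rfl
      · rw [← hv, h.proj_proj_ne hij, smul_zero, smul_zero]
    exact fun v => LinearMap.congr_fun this v
  refine aeval_nodal_eq_zero_of_filtration (fun i => ⨅ j : Fin i, LinearMap.ker (P j)) ?_ ?_ ?_
  · simp
  · refine eq_bot_iff.2 fun v hv => ?_
    simp only [Submodule.mem_iInf, LinearMap.mem_ker] at hv
    rw [Submodule.mem_bot, ← h.sum_proj v]
    exact sum_eq_zero fun i hi => hv ⟨i, by simpa using hi⟩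
  · intro i _ v hv
    simp only [Submodule.mem_iInf, LinearMap.mem_ker, map_sub, map_smul] at hv ⊢
    rintro ⟨j, hj⟩
    rcases j with _ | j
    · simp only [hPS0]
      rcases Nat.eq_zero_or_pos i with rfl | hi
      · simp
      · simp [hv ⟨0, hi⟩]
    · simp only [hPS, hv ⟨j, by omega⟩, map_zero, add_zero]
      rcases Nat.lt_or_eq_of_le (Nat.lt_succ_iff.1 hj) with hi | rfl
      · simp [hv ⟨j + 1, hi⟩]
      · simp

theorem aeval_nodal_of_lower (h : IsEigengrading T d θ P) {S N : Module.End K V}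
    {μ : ℕ → K} (hS : ∀ i v, P i v = v → S v = μ i • v + N v)
    (hN : ∀ i v, P i (N v) = N (P (i + 1) v)) :
    aeval S (Lagrange.nodal (range (d + 1)) μ) = 0 := by
  have hPS : ∀ i v, P i (S v) = μ i • P i v + N (P (i + 1) v) := by
    intro i
    have : P i * S = μ i • P i + N * P (i + 1) := h.ext fun j _ v hv => by
      simp only [Module.End.mul_apply, hS j v hv, map_add, map_smul, hN, LinearMap.add_apply,
        LinearMap.smul_apply]
      congr 1
      rcases eq_or_ne i j with rfl | hij
      · rfl
      · rw [← hv, h.proj_proj_ne hij, smul_zero, smul_zero]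
    exact fun v => LinearMap.congr_fun this v
  -- A lowering map preserves the opposite filtration, by degrees `≤ d - i`, so the diagonal entries
  -- are met in reverse order.
  have key : aeval S (Lagrange.nodal (range (d + 1)) fun i => μ (d - i)) = 0 := by
    refine aeval_nodal_eq_zero_of_filtration
      (fun i => ⨅ j : {j : ℕ // d < j + i}, LinearMap.ker (P j)) ?_ ?_ ?_
    · refine eq_top_iff.2 fun v _ => ?_
      simp only [Submodule.mem_iInf, LinearMap.mem_ker]
      rintro ⟨j, hj⟩
      simp [h.proj_eq_zero j (by omega)]
    · refine eq_bot_iff.2 fun v hv => ?_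
      simp only [Submodule.mem_iInf, LinearMap.mem_ker] at hv
      rw [Submodule.mem_bot, ← h.sum_proj v]
      exact sum_eq_zero fun i _ => hv ⟨i, by omega⟩
    · intro i hi v hv
      simp only [Submodule.mem_iInf, LinearMap.mem_ker, map_sub, map_smul] at hv ⊢
      rintro ⟨j, hj⟩
      simp only [hPS, hv ⟨j + 1, by omega⟩, map_zero, add_zero]
      by_cases hji : d < j + i
      · simp [hv ⟨j, hji⟩]
      · obtain rfl : j = d - i := by omega
        simp
  rw [Lagrange.nodal] at key ⊢
  rw [← key, ← prod_range_reflect]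
  simp

end IsEigengrading

end Eigengrading

/-! ### Primitive vectors, trace duality and lowering maps for a Lefschetz operator. -/

section Lefschetz

variable {K V : Type*} [Field K] [AddCommGroup V] [Module K V]

/-- The map `e` raises the degree of the grading with projections `P 0, …, P d` by one, and
`e ^ (d - 2 i)` restricts to a bijection from the `i`-th to the `(d - i)`-th component. -/
structure IsLefschetz (d : ℕ) (P : ℕ → Module.End K V) (e : Module.End K V) : Prop where
  proj_zero_raise : ∀ v, P 0 (e v) = 0
  proj_raise : ∀ i v, P (i + 1) (e v) = e (P i v)
  injective : ∀ i, 2 * i ≤ d → ∀ v, P i v = v → (e ^ (d - 2 * i)) v = 0 → v = 0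
  surjective : ∀ i, 2 * i ≤ d → ∀ w, P (d - i) w = w → ∃ v, P i v = v ∧ (e ^ (d - 2 * i)) v = w

namespace IsLefschetz

variable {T T' : Module.End K V} {d : ℕ} {θ θ' : ℕ → K} {P P' : ℕ → Module.End K V}
  {e : Module.End K V}

theorem proj_pow (he : IsLefschetz d P e) (n i : ℕ) (v : V) :
    P (i + n) ((e ^ n) v) = (e ^ n) (P i v) := by
  induction n with
  | zero => rfl
  | succ n ih => rw [pow_succ', Module.End.mul_apply, ← add_assoc, he.proj_raise, ih,
      Module.End.mul_apply]

/-- An induction principle for homogeneous vectors: they are generated from primitive vectors by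
the action of `e`. -/
theorem homogeneous_induction (hT : IsEigengrading T d θ P) (he : IsLefschetz d P e)
    {motive : ℕ → V → Prop}
    (primitive : ∀ s v, 2 * s ≤ d → P s v = v → (e ^ (d - 2 * s + 1)) v = 0 → motive s v)
    (add : ∀ i v w, motive i v → motive i w → motive i (v + w))
    (raise : ∀ i v, motive i v → motive (i + 1) (e v)) {i : ℕ} (hi : i ≤ d) {v : V}
    (hv : P i v = v) : motive i v := by
  have lower : ∀ i, 2 * i ≤ d → ∀ v, P i v = v → motive i v := by
    intro i
    induction i with
    | zero =>
      intro _ v hv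
      refine primitive 0 v (by omega) hv ?_
      -- There is nothing in degree `d + 1`, so every vector of degree `0` is primitive.
      have h1 := he.proj_pow (d + 1) 0 v
      rw [hT.proj_eq_zero _ (by omega), hv] at h1
      exact h1.symm
    | succ i ih =>
      intro hi v hv
      have h1 := he.proj_pow (d - 2 * (i + 1) + 1) (i + 1) v
      rw [hv, show i + 1 + (d - 2 * (i + 1) + 1) = d - i by omega] at h1
      -- The image of `v` in degree `d - i` also comes from some `u` of degree `i`. Subtracting `e
      -- u` from `v` leaves a primitive vector.
      obtain ⟨u, hu, hu'⟩ := he.surjective i (by omega) _ h1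
      have h2 : motive (i + 1) (v - e u) := by
        refine primitive (i + 1) _ hi ?_ ?_
        · rw [map_sub, hv, he.proj_raise, hu]
        · rw [map_sub, ← hu', ← Module.End.mul_apply, ← pow_succ,
            show d - 2 * (i + 1) + 1 + 1 = d - 2 * i by omega, sub_self]
      simpa using add _ _ _ h2 (raise i u (ih (by omega) u hu))
  by_cases h : 2 * i ≤ d
  · exact lower i h v hv
  -- Above the middle degree, `v` is a power of `e` applied to a vector of the mirror degree.
  · obtain ⟨u, hu, hu'⟩ := he.surjective (d - i) (by omega) v
      (by rwa [show d - (d - i) = i by omega])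
    have h1 : ∀ n, motive (d - i + n) ((e ^ n) u) := by
      intro n
      induction n with
      | zero => exact lower _ (by omega) u hu
      | succ n ih =>
        rw [pow_succ', Module.End.mul_apply, ← add_assoc]
        exact raise _ _ ih
    have h2 := h1 (d - 2 * (d - i))
    rwa [hu', show d - i + (d - 2 * (d - i)) = i by omega] at h2

/-- Two gradings with the Lefschetz property for the same map have the same filtration. -/
theorem proj_eq_zero_of_lt (hT : IsEigengrading T d θ P) (he : IsLefschetz d P e)
    (hT' : IsEigengrading T' d θ' P') (he' : IsLefschetz d P' e) {i : ℕ} {v : V}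
    (hv : P i v = v) {j : ℕ} (hj : j < i) : P' j v = 0 := by
  by_cases hi : i ≤ d
  swap
  · rw [← hv, hT.proj_eq_zero i (by omega), LinearMap.zero_apply, map_zero]
  refine homogeneous_induction hT he (motive := fun i v => ∀ j < i, P' j v = 0)
    ?_ ?_ ?_ hi hv j hj
  -- The component of `v` in degree `k < s` of the second grading is also killed by `e ^ (d - 2 s +
  -- 1)`, hence by `e ^ (d - 2 k)`, which is injective there.
  · intro s v hs hv hprim k hk
    refine he'.injective k (by omega) _ (hT'.proj_proj k v) ?_
    have h1 := he'.proj_pow (d - 2 * s + 1) k v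
    rw [hprim, map_zero] at h1
    rw [show d - 2 * k = (d - 2 * k - (d - 2 * s + 1)) + (d - 2 * s + 1) by omega, pow_add,
      Module.End.mul_apply, ← h1, map_zero]
  · intro i v w hv hw j hj
    rw [map_add, hv j hj, hw j hj, add_zero]
  · intro i v hv j hj
    rcases j with _ | j
    · exact he'.proj_zero_raise v
    · rw [he'.proj_raise, hv j (by omega), map_zero]

/-- A map of degree `-1` which commutes with `e` is zero. -/
theorem eq_zero_of_commute (hT : IsEigengrading T d θ P) (he : IsLefschetz d P e)
    {g : Module.End K V} (hg : ∀ i v, P i (g v) = g (P (i + 1) v))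
    (hge : ∀ v, g (e v) = e (g v)) : g = 0 := by
  refine hT.ext fun i hi v hv => ?_
  rw [LinearMap.zero_apply]
  refine homogeneous_induction hT he (motive := fun _ v => g v = 0) ?_ ?_ ?_ hi hv
  · intro s v hs hv hprim
    rcases s with _ | s
    · refine hT.ext_of_forall_proj fun i => ?_
      rw [hg, map_zero, ← hv, hT.proj_proj_ne (by omega), map_zero]
    -- Since `g` commutes with `e`, the vector `g v` of degree `s` is killed by a power of `e`
    -- smaller than the one that is injective in degree `s`.
    · refine he.injective s (by omega) _ (by rw [hg, hv]) ?_
      have h1 : ∀ n, (e ^ n) (g v) = g ((e ^ n) v) := by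
        intro n
        induction n with
        | zero => rfl
        | succ n ih => rw [pow_succ', Module.End.mul_apply, Module.End.mul_apply, ih, hge]
      rw [show d - 2 * s = 1 + (d - 2 * (s + 1) + 1) by omega, pow_add, Module.End.mul_apply, h1,
        hprim, map_zero, map_zero]
  · intro i v w hv hw
    rw [map_add, hv, hw, add_zero]
  · intro i v hv
    rw [hge, hv, map_zero]

end IsLefschetz

section Trace

variable [FiniteDimensional K V]

/-- Nondegeneracy of the trace form: pairing `g` with the rank one map built from `φ` and `v` gives
`φ (g v)`. -/
theorem eq_zero_of_trace_mul_eq_zero {g : Module.End K V}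
    (hg : ∀ a : Module.End K V, LinearMap.trace K V (g * a) = 0) : g = 0 := by
  ext v
  rw [LinearMap.zero_apply, ← Module.forall_dual_apply_eq_zero_iff K]
  intro φ
  have h1 : g * dualTensorHom K V V (φ ⊗ₜ v) = dualTensorHom K V V (φ ⊗ₜ g v) := by
    ext w
    simp [dualTensorHom_apply]
  have h2 := hg (dualTensorHom K V V (φ ⊗ₜ v))
  rwa [h1, LinearMap.trace_eq_contract_apply, contractLeft_apply] at h2

theorem exists_trace_mul_eq (ℓ : Module.Dual K (Module.End K V)) :
    ∃ g : Module.End K V, ∀ a, ℓ a = LinearMap.trace K V (g * a) := by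
  let Φ : Module.End K V →ₗ[K] Module.Dual K (Module.End K V) :=
    (LinearMap.mul K (Module.End K V)).compr₂ (LinearMap.trace K V)
  have hinj : Function.Injective Φ := by
    refine (injective_iff_map_eq_zero Φ).2 fun g hg => eq_zero_of_trace_mul_eq_zero fun a => ?_
    exact LinearMap.congr_fun hg a
  obtain ⟨g, hg⟩ := (LinearMap.injective_iff_surjective_of_finrank_eq_finrank
    (Subspace.dual_finrank_eq (K := K)).symm).1 hinj ℓ
  exact ⟨g, fun a => by rw [← hg]; rfl⟩

/-- If `D` is orthogonal to the centralizer of `e` under the trace form, then `D` is a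
commutator with `e`. -/
theorem exists_commutator_eq {e D : Module.End K V}
    (h : ∀ g, g * e = e * g → LinearMap.trace K V (g * D) = 0) :
    ∃ f, e * f - f * e = D := by
  let φ : Module.End K V →ₗ[K] Module.End K V := LinearMap.mulLeft K e - LinearMap.mulRight K e
  by_contra hD
  have hD' : D ∉ LinearMap.range φ := fun ⟨f, hf⟩ => hD ⟨f, hf⟩
  -- A functional that vanishes on the image of `ad e` but not at `D` is a trace pairing with some
  -- `g`. Its vanishing on that image says that `g` commutes with `e`, contrary to the hypothesis on
  -- `D`.
  obtain ⟨ℓ, hℓ, hker⟩ := Submodule.exists_le_ker_of_notMem hD'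
  obtain ⟨g, hg⟩ := exists_trace_mul_eq ℓ
  refine hℓ ((hg D).trans (h g ?_))
  refine sub_eq_zero.1 (eq_zero_of_trace_mul_eq_zero fun a => ?_)
  have h1 : ℓ (φ a) = 0 := hker ⟨a, rfl⟩
  rw [hg] at h1
  simp only [φ, LinearMap.sub_apply, LinearMap.mulLeft_apply, LinearMap.mulRight_apply, mul_sub,
    map_sub] at h1
  rw [sub_mul, map_sub, ← h1, mul_assoc, mul_assoc, ← mul_assoc g a e,
    LinearMap.trace_mul_comm K (g * a) e]

end Trace

namespace IsLefschetz

variable {T : Module.End K V} {d : ℕ} {θ : ℕ → K} {P : ℕ → Module.End K V}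
  {e : Module.End K V}

/-- With `R` the inverse of `e ^ k` between the two components, extended by zero, `P (d - i) = e ^ k
* R` and `P i = R * e ^ k`. As `g` commutes with `e ^ k`, cyclicity of the trace gives the equality.
-/
theorem trace_mul_proj [FiniteDimensional K V] (hT : IsEigengrading T d θ P)
    (he : IsLefschetz d P e) {i : ℕ} (hi : 2 * i ≤ d)
    {g : Module.End K V} (hg : g * e = e * g) :
    LinearMap.trace K V (g * P (d - i)) = LinearMap.trace K V (g * P i) := by
  set k := d - 2 * i with hk
  have hgk : g * e ^ k = e ^ k * g := ((Commute.pow_right (show Commute g e from hg)) k).eq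
  have hek : ∀ v, P (d - i) ((e ^ k) v) = (e ^ k) (P i v) := fun v => by
    rw [← he.proj_pow, show i + k = d - i by omega]
  choose r hr using fun w => he.surjective i hi (P (d - i) w) (hT.proj_proj _ w)
  have hinj : ∀ u v, P i u = u → P i v = v → (e ^ k) u = (e ^ k) v → u = v := by
    intro u v hu hv huv
    exact sub_eq_zero.1 (he.injective i hi _ (by rw [map_sub, hu, hv])
      (by rw [map_sub, huv, sub_self]))
  let R : Module.End K V :=
    { toFun := r
      map_add' := fun v w => hinj _ _ (hr _).1 (by rw [map_add, (hr v).1, (hr w).1])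
        (by rw [(hr _).2, map_add, map_add, (hr v).2, (hr w).2])
      map_smul' := fun c v => hinj _ _ (hr _).1 (by rw [RingHom.id_apply, map_smul, (hr v).1])
        (by rw [(hr _).2, RingHom.id_apply, map_smul, map_smul, (hr v).2]) }
  have h1 : P (d - i) = e ^ k * R := LinearMap.ext fun v => ((hr v).2).symm
  have h2 : R * e ^ k = P i := LinearMap.ext fun v =>
    hinj _ _ (hr _).1 (hT.proj_proj i v) (((hr _).2).trans (hek v))
  rw [h1, ← mul_assoc, hgk, mul_assoc, LinearMap.trace_mul_comm, mul_assoc, h2]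

/-- Completion of `e` by a map of degree `-1` with a prescribed commutator, as in the
Jacobson–Morozov theorem. -/
theorem exists_lowering [CharZero K] [FiniteDimensional K V] (hT : IsEigengrading T d θ P)
    (he : IsLefschetz d P e) {c : ℕ → K} (hc : ∀ i ≤ d, c (d - i) = - c i) :
    ∃ L : Module.End K V, (∀ i v, P i (L v) = L (P (i + 1) v)) ∧
      ∀ i v, P i v = v → e (L v) - L (e v) = c i • v := by
  obtain ⟨f, hf⟩ : ∃ f, e * f - f * e = ∑ i ∈ range (d + 1), c i • P i := by
    refine exists_commutator_eq fun g hg => ?_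
    have htr : ∀ i ≤ d, LinearMap.trace K V (g * P (d - i)) = LinearMap.trace K V (g * P i) := by
      intro i hi
      by_cases h : 2 * i ≤ d
      · exact he.trace_mul_proj hT h hg
      · rw [← he.trace_mul_proj hT (i := d - i) (by omega) hg, show d - (d - i) = i by omega]
    rw [mul_sum, map_sum]
    -- Reflection of degrees turns the sum into its negative, so it vanishes in characteristic zero.
    have h1 : ∀ i ∈ range (d + 1), LinearMap.trace K V (g * c (d + 1 - 1 - i) • P (d + 1 - 1 - i))
        = - LinearMap.trace K V (g * c i • P i) := by
      intro i hi
      have hi' : i ≤ d := by simpa [Nat.lt_succ_iff] using hi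
      rw [Nat.add_sub_cancel, mul_smul_comm, mul_smul_comm, map_smul, map_smul, hc i hi',
        htr i hi', neg_smul]
    have h2 := sum_range_reflect (fun i => LinearMap.trace K V (g * c i • P i)) (d + 1)
    rw [sum_congr rfl h1, sum_neg_distrib] at h2
    exact self_eq_neg.1 h2.symm
  have hf' : ∀ i v, P i v = v → e (f v) - f (e v) = c i • v := by
    intro i v hv
    have h1 := LinearMap.congr_fun hf v
    simp only [LinearMap.sub_apply, Module.End.mul_apply, LinearMap.sum_apply,
      LinearMap.smul_apply] at h1
    rw [h1]
    by_cases hi : i ≤ d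
    · rw [sum_eq_single i, hv]
      · intro j _ hj
        rw [← hv, hT.proj_proj_ne hj, smul_zero]
      · intro h; simp at h; omega
    · rw [← hv, hT.proj_eq_zero i (by omega)]
      simp
  -- The degree `-1` part of `f`. The prescribed commutator has degree `0` and `e` has degree `1`,
  -- so only this part of `f` contributes.
  let L : Module.End K V := ∑ i ∈ range d, P i * f * P (i + 1)
  have hL0 : ∀ v, P 0 v = v → L v = 0 := by
    intro v hv
    simp only [L, LinearMap.sum_apply, Module.End.mul_apply]
    refine sum_eq_zero fun i _ => ?_
    rw [← hv, hT.proj_proj_ne (by omega), map_zero, map_zero]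
  have hL : ∀ i v, P (i + 1) v = v → L v = P i (f v) := by
    intro i v hv
    by_cases hi : i + 1 ≤ d
    · simp only [L, LinearMap.sum_apply, Module.End.mul_apply]
      rw [sum_eq_single i, hv]
      · intro j _ hj
        rw [← hv, hT.proj_proj_ne (by omega), map_zero, map_zero]
      · intro h; simp at h; omega
    · rw [← hv, hT.proj_eq_zero (i + 1) (by omega)]
      simp
  refine ⟨L, fun i v => ?_, fun i v hv => ?_⟩
  · refine hT.lower_of_eigen (fun v hv => hL0 v (hT.proj_of_eigen 0 v hv)) (fun i v hv => ?_) i v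
    rw [hL i v (hT.proj_of_eigen _ v hv)]
    exact hT.apply_proj i _
  · have hev : P (i + 1) (e v) = e v := by rw [he.proj_raise, hv]
    rw [hL i (e v) hev]
    have h2 : P i (e (f v)) - P i (f (e v)) = c i • v := by
      rw [← map_sub, hf' i v hv, map_smul, hv]
    rcases i with _ | i
    · rw [hL0 v hv, map_zero, ← h2, he.proj_zero_raise]
    · rw [hL i v hv, ← he.proj_raise, h2]

end IsLefschetz

end Lefschetz

/-! ### Bidiagonal pairs as Lefschetz structures. -/

section PairStructure

variable {K V : Type*} [Field K] [AddCommGroup V] [Module K V] {A As : Module.End K V}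
  {d : ℕ} {θ : ℕ → K}

theorem apply_eq_of_mem_orderedEigenspace {i : ℕ} {v : V}
    (hv : v ∈ orderedEigenspace A d θ i) : A v = θ i • v := by
  unfold orderedEigenspace at hv
  split_ifs at hv with hi
  · exact Module.End.mem_eigenspace_iff.1 hv
  · simp [(Submodule.mem_bot K).1 hv]

theorem IsEigengrading.mem_orderedEigenspace_iff {P : ℕ → Module.End K V}
    (h : IsEigengrading A d θ P) (i : ℕ) (v : V) :
    v ∈ orderedEigenspace A d θ i ↔ P i v = v := by
  refine ⟨fun hv => h.proj_of_eigen i v (apply_eq_of_mem_orderedEigenspace hv), fun hv => ?_⟩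
  unfold orderedEigenspace
  split_ifs with hi
  · exact Module.End.mem_eigenspace_iff.2 ((h.eigen_iff i v).2 hv)
  · rw [← hv, h.proj_eq_zero i (by omega)]
    simp

/-- The component of `As v` in `V_i` has the same `A`-eigenvalue as `v`, so it drops out of the
commutator; the next component is multiplied by the difference of eigenvalues. -/
theorem IsEigenvalueSequence.commutator_mem (h : IsEigenvalueSequence A As d θ) {i : ℕ} {v : V}
    (hv : v ∈ orderedEigenspace A d θ i) :
    (A * As - As * A) v ∈ orderedEigenspace A d θ (i + 1) := by
  by_cases hi : i ≤ d
  · obtain ⟨a, ha, b, hb, hab⟩ := Submodule.mem_sup.1 (h.2 i hi (Submodule.mem_map_of_mem hv))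
    have h1 : (A * As - As * A) v = (θ (i + 1) - θ i) • b := by
      simp only [LinearMap.sub_apply, Module.End.mul_apply]
      rw [apply_eq_of_mem_orderedEigenspace hv, map_smul, ← hab, map_add,
        apply_eq_of_mem_orderedEigenspace ha, apply_eq_of_mem_orderedEigenspace hb]
      module
    rw [h1]
    exact Submodule.smul_mem _ _ hb
  · have h0 : v = 0 := by simpa [orderedEigenspace, hi] using hv
    simp [h0]

theorem IsEigenvalueOrdering.ncard_eq (h : IsEigenvalueOrdering A d θ) :
    {μ : K | A.HasEigenvalue μ}.ncard = d + 1 := by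
  rw [← h.2, h.1.ncard_image, ← Finset.coe_Iic, Set.ncard_coe_finset, Nat.card_Iic]

theorem IsEigenvalueOrdering.eq_of_eq {D : ℕ} {η : ℕ → K} (h : IsEigenvalueOrdering A d θ)
    (h' : IsEigenvalueOrdering A D η) : D = d := by
  have := h.ncard_eq
  have := h'.ncard_eq
  omega

/-- The eigenvalue sequence is determined by the pair. -/
theorem IsEigenvalueSequence.unique {η : ℕ → K} (h : IsEigenvalueSequence A As d θ)
    (hb : HasBijections (A * As - As * A) A d θ) (h' : IsEigenvalueSequence A As d η) :
    ∀ i ≤ d, θ i = η i := by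
  set C := A * As - As * A with hC
  have hpow : ∀ v ∈ orderedEigenspace A d θ 0, ∀ n,
      (C ^ n) v ∈ orderedEigenspace A d θ n := by
    intro v hv n
    induction n with
    | zero => exact hv
    | succ n ih =>
      rw [pow_succ', Module.End.mul_apply]
      exact h.commutator_mem ih
  have hex : ∀ i ≤ d, ∃ j ≤ d, η j = θ i := fun i hi => by
    have h1 : θ i ∈ η '' Set.Iic d := by
      rw [h'.1.2, ← h.1.2]
      exact ⟨i, hi, rfl⟩
    exact h1
  -- A starting vector for a chain `v, C v, …, C ^ d v` with no zero term. It meets every eigenspace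
  -- of `A`.
  obtain ⟨v, hv, hCv⟩ : ∃ v ∈ orderedEigenspace A d θ 0, (C ^ d) v ≠ 0 := by
    have h1 : A.HasEigenvalue (θ d) := by
      have : θ d ∈ {μ : K | A.HasEigenvalue μ} := h.1.2 ▸ ⟨d, le_refl d, rfl⟩
      exact this
    obtain ⟨w, hw, hw0⟩ := h1.exists_hasEigenvector
    obtain ⟨v, hv, hvw⟩ := (hb 0 (by omega)).surjOn
      (show w ∈ (orderedEigenspace A d θ (d - 0) : Set V) by simpa [orderedEigenspace] using hw)
    refine ⟨v, hv, ?_⟩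
    simp only [mul_zero, Nat.sub_zero] at hvw
    rwa [hvw]
  -- `C` also raises the index for `η`, so the nonzero chain moves in step through both orderings.
  have hstep : ∀ i < d, ∀ j ≤ d, η j = θ i → j + 1 ≤ d ∧ η (j + 1) = θ (i + 1) := by
    intro i hi j hj hij
    have hne : (C ^ (i + 1)) v ≠ 0 := by
      intro h0
      refine hCv ?_
      rw [show d = (d - (i + 1)) + (i + 1) by omega, pow_add, Module.End.mul_apply, h0, map_zero]
    have hmem := hpow v hv (i + 1)
    have hmem' : (C ^ (i + 1)) v ∈ orderedEigenspace A d η (j + 1) := by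
      rw [pow_succ', Module.End.mul_apply]
      refine h'.commutator_mem ?_
      rw [orderedEigenspace, if_pos hj, Module.End.mem_eigenspace_iff, hij]
      exact apply_eq_of_mem_orderedEigenspace (hpow v hv i)
    refine ⟨?_, ?_⟩
    · by_contra hcon
      rw [orderedEigenspace, if_neg hcon] at hmem'
      exact hne ((Submodule.mem_bot K).1 hmem')
    · have h1 := apply_eq_of_mem_orderedEigenspace hmem
      rw [apply_eq_of_mem_orderedEigenspace hmem'] at h1
      exact smul_left_injective K hne h1
  obtain ⟨j, hj, hj0⟩ := hex 0 (by omega)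
  have hall : ∀ i ≤ d, j + i ≤ d ∧ η (j + i) = θ i := by
    intro i
    induction i with
    | zero => exact fun _ => ⟨hj, hj0⟩
    | succ i ih =>
      intro hi
      obtain ⟨h1, h2⟩ := ih (by omega)
      exact hstep i (by omega) (j + i) h1 h2
  -- A chain of `d + 1` nonzero terms leaves no room for a shift of index.
  obtain rfl : j = 0 := by have := (hall d le_rfl).1; omega
  intro i hi
  rw [← (hall i hi).2, zero_add]

theorem HasBijections.congr {C : Module.End K V} {η : ℕ → K} (hb : HasBijections C A d θ)
    (h : ∀ i ≤ d, θ i = η i) : HasBijections C A d η := by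
  have h1 : ∀ i, orderedEigenspace A d θ i = orderedEigenspace A d η i := by
    intro i
    unfold orderedEigenspace
    split_ifs with hi
    · rw [h i hi]
    · rfl
  intro i hi
  rw [← h1, ← h1]
  exact hb i hi

theorem IsEigenvalueOrdering.exists_isEigengrading (h : IsEigenvalueOrdering A d θ)
    (hA : IsDiagonalizable A) (hθ : Function.Injective θ) : ∃ P, IsEigengrading A d θ P := by
  refine BidiagonalPair.exists_isEigengrading hθ (aeval_nodal_eq_zero_of_span (eq_top_iff.2 ?_))
  rw [← hA]
  refine iSup_le fun μ v hv => ?_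
  rcases eq_or_ne v 0 with rfl | hv0
  · exact Submodule.zero_mem _
  · have h1 : A.HasEigenvalue μ := Module.End.hasEigenvalue_of_hasEigenvector ⟨hv, hv0⟩
    obtain ⟨i, hi, rfl⟩ : μ ∈ θ '' Set.Iic d := h.2 ▸ h1
    exact Submodule.subset_span ⟨i, hi, Module.End.mem_eigenspace_iff.1 hv⟩

theorem HasBijections.isLefschetz {P : ℕ → Module.End K V} {C : Module.End K V}
    (hb : HasBijections C A d θ) (hP : IsEigengrading A d θ P)
    (hC : ∀ i, ∀ v ∈ orderedEigenspace A d θ i, C v ∈ orderedEigenspace A d θ (i + 1)) :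
    IsLefschetz d P C := by
  obtain ⟨h0, h1⟩ := hP.raise_of_eigen (N := C) fun i v hv =>
    apply_eq_of_mem_orderedEigenspace
      (hC i v ((hP.mem_orderedEigenspace_iff i v).2 (hP.proj_of_eigen i v hv)))
  refine ⟨h0, h1, fun i hi v hv hv0 => ?_, fun i hi w hw => ?_⟩
  · refine (hb i hi).injOn ((hP.mem_orderedEigenspace_iff i v).2 hv) (Submodule.zero_mem _) ?_
    rw [hv0, map_zero]
  · obtain ⟨v, hv, hvw⟩ := (hb i hi).surjOn ((hP.mem_orderedEigenspace_iff _ w).2 hw)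
    exact ⟨v, (hP.mem_orderedEigenspace_iff i v).1 hv, hvw⟩

/-- The action of `As` on the eigenspaces of `A`, for a bidiagonal pair `A, As`. -/
theorem IsBidiagonalPair.exists_isLefschetz {θs : ℕ → K} (hpair : IsBidiagonalPair A As)
    (h : IsEigenvalueSequence A As d θ) (hs : IsEigenvalueSequence As A d θs)
    (hθ : Function.Injective θ) (hθs : Function.Injective θs) :
    ∃ P, IsEigengrading A d θ P ∧ IsLefschetz d P (A * As - As * A) ∧
      ∀ i v, P i v = v →
        As v = θs i • v + (θ (i + 1) - θ i)⁻¹ • (A * As - As * A) v := by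
  obtain ⟨hA, hAs, d₁, d₂, η, ηs, h₁, h₂, hb₂, hb₁⟩ := hpair
  obtain rfl := h₁.1.eq_of_eq h.1
  obtain rfl := h₂.1.eq_of_eq hs.1
  have hbA := hb₁.congr (h₁.unique hb₁ h)
  -- Exchanging the roles of the two maps negates the commutator, which does not affect bijectivity
  -- between subspaces.
  have hbAs := hb₂.congr (IsEigenvalueSequence.unique (A := As) (As := A) h₂ (fun i hi => by
    have h1 : As * A - A * As = - (A * As - As * A) := by abel
    have h2 := hb₂ i hi
    rw [h1]
    rcases Nat.even_or_odd (d - 2 * i) with he | ho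
    · rwa [he.neg_pow]
    · rw [ho.neg_pow]
      refine ⟨fun v hv => ?_, fun u hu v hv huv => ?_, fun w hw => ?_⟩
      · exact Submodule.neg_mem _ (h2.mapsTo hv)
      · exact h2.injOn hu hv (neg_injective huv)
      · obtain ⟨v, hv, hvw⟩ := h2.surjOn (Submodule.neg_mem _ hw)
        exact ⟨v, hv, by rw [LinearMap.neg_apply, hvw, neg_neg]⟩) hs)
  obtain ⟨P, hP⟩ := h.1.exists_isEigengrading hA hθ
  obtain ⟨Q, hQ⟩ := hs.1.exists_isEigengrading hAs hθs
  have hPC : IsLefschetz d P (A * As - As * A) :=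
    hbA.isLefschetz hP fun i v hv => h.commutator_mem hv
  have hQC : IsLefschetz d Q (A * As - As * A) := hbAs.isLefschetz hQ fun i v hv => by
    rw [← neg_sub (As * A)]
    exact Submodule.neg_mem _ (hs.commutator_mem hv)
  refine ⟨P, hP, hPC, fun i v hv => ?_⟩
  by_cases hi : i ≤ d
  swap
  · rw [← hv, hP.proj_eq_zero i (by omega)]
    simp
  have hv' := (hP.mem_orderedEigenspace_iff i v).2 hv
  have hAv := apply_eq_of_mem_orderedEigenspace hv'
  obtain ⟨a, ha, b, hb, hab⟩ := Submodule.mem_sup.1 (h.2 i hi (Submodule.mem_map_of_mem hv'))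
  -- By equality of the filtrations `v` has no components in `V*_j` for `j < i`, and `As - θs i`
  -- kills its component in `V*_i`.
  have hw : ∀ j ≤ i, Q j (As v - θs i • v) = 0 := by
    intro j hj
    rw [map_sub, map_smul, ← hQ.apply_eq, hQ.apply_proj, ← sub_smul]
    rcases Nat.lt_or_eq_of_le hj with hj | rfl
    · rw [hPC.proj_eq_zero_of_lt hP hQ hQC hv hj, smul_zero]
    · rw [sub_self, zero_smul]
  -- Equality of the filtrations in the other direction: what remains lies in degrees above `i` for
  -- `As`, hence for `A`.
  have hPw : P i (As v - θs i • v) = 0 := by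
    rw [← hQ.sum_proj (As v - θs i • v), map_sum]
    refine sum_eq_zero fun j _ => ?_
    rcases Nat.lt_or_ge i j with hj | hj
    · exact hQC.proj_eq_zero_of_lt hQ hP hPC (hQ.proj_proj j _) hj
    · rw [hw j hj, map_zero]
  have ha' : a = θs i • v := by
    rw [← hab, map_sub, map_add, (hP.mem_orderedEigenspace_iff i a).1 ha, map_smul, hv,
      hP.proj_of_eigen_ne i (i + 1) b (by omega) (apply_eq_of_mem_orderedEigenspace hb),
      add_zero] at hPw
    exact sub_eq_zero.1 hPw
  have hC : (A * As - As * A) v = (θ (i + 1) - θ i) • b := by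
    simp only [LinearMap.sub_apply, Module.End.mul_apply]
    rw [hAv, map_smul, ← hab, map_add, apply_eq_of_mem_orderedEigenspace ha,
      apply_eq_of_mem_orderedEigenspace hb]
    module
  have hne : θ (i + 1) - θ i ≠ 0 := sub_ne_zero.2 (hθ.ne (by omega))
  rw [hC, inv_smul_smul₀ hne, ← hab, ha']

end PairStructure

/-! ### Base `1`: the action of `sl₂` and the spectrum of `h`. -/

section LieCase

attribute [local instance] LieRing.ofAssociativeRing

variable {K V : Type*} [Field K] [AddCommGroup V] [Module K V]

theorem arithmetic_injective [CharZero K] (d : ℕ) :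
    Function.Injective fun i : ℕ => 2 * (i : K) - (d : K) := by
  intro i j hij
  simpa using hij

/-- The sum of `T` and an eigenvector of `ad T` for the eigenvalue `2` has the same eigenvalues
as `T`, when the eigenvalues of `T` form an arithmetic progression with difference `2`. -/
theorem span_eigen_add_eq_top [CharZero K] {T N : Module.End K V} {d : ℕ}
    (hT : Submodule.span K {v : V | ∃ i ≤ d, T v = (2 * (i : K) - d) • v} = ⊤)
    (hN : T * N - N * T = (2 : K) • N) :
    Submodule.span K {v : V | ∃ i ≤ d, (T + N) v = (2 * (i : K) - d) • v} = ⊤ := by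
  obtain ⟨P, hP⟩ := exists_isEigengrading (arithmetic_injective (K := K) d)
    (aeval_nodal_eq_zero_of_span hT)
  obtain ⟨h0, h1⟩ := hP.raise_of_eigen (N := N) fun i v hv => by
    have h2 := LinearMap.congr_fun hN v
    simp only [LinearMap.sub_apply, Module.End.mul_apply, LinearMap.smul_apply, hv,
      map_smul] at h2
    rw [sub_eq_iff_eq_add.1 h2]
    push_cast
    module
  obtain ⟨Q, hQ⟩ := exists_isEigengrading (arithmetic_injective (K := K) d)
    (hP.aeval_nodal_of_raise (S := T + N) (fun i v hv => by
      rw [LinearMap.add_apply, (hP.eigen_iff i v).2 hv]) h0 h1)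
  exact hQ.span_eq_top

theorem span_eigen_neg_eq_top {T : Module.End K V} {d : ℕ}
    (hT : Submodule.span K {v : V | ∃ i ≤ d, T v = (2 * (i : K) - d) • v} = ⊤) :
    Submodule.span K {v : V | ∃ i ≤ d, (-T) v = (2 * (i : K) - d) • v} = ⊤ := by
  rw [← hT]
  congr 1
  ext v
  have key : ∀ S : Module.End K V, (∃ i ≤ d, S v = (2 * (i : K) - d) • v) →
      ∃ i ≤ d, (-S) v = (2 * (i : K) - d) • v := by
    rintro S ⟨i, hi, hv⟩
    refine ⟨d - i, by omega, ?_⟩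
    rw [LinearMap.neg_apply, hv, Nat.cast_sub hi]
    module
  exact ⟨fun h => by simpa using key _ h, key T⟩

/-- For a reduced pair with base `1`, the map by which the third element of an equitable basis
has to act. -/
theorem exists_equitable_third [CharZero K] [FiniteDimensional K V] {A As : Module.End K V}
    {d : ℕ} {P : ℕ → Module.End K V}
    (hP : IsEigengrading A d (fun i : ℕ => 2 * (i : K) - d) P)
    (he : IsLefschetz d P (A * As - As * A))
    (hAs : ∀ i v, P i v = v →
      As v = ((d : K) - 2 * i) • v + (2 : K)⁻¹ • (A * As - As * A) v) :
    A * As - As * A = (2 : K) • A + (2 : K) • As ∧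
    ∃ B : Module.End K V, (B * A - A * B = (2 : K) • B + (2 : K) • A ∧
      As * B - B * As = (2 : K) • As + (2 : K) • B) ∧
      ∀ X : Module.End K V, X * A - A * X = (2 : K) • X + (2 : K) • A →
        As * X - X * As = (2 : K) • As + (2 : K) • X → X = B := by
  have hC : A * As - As * A = (2 : K) • A + (2 : K) • As := by
    refine hP.ext fun i _ v hv => ?_
    rw [LinearMap.add_apply, LinearMap.smul_apply, LinearMap.smul_apply, hAs i v hv,
      (hP.eigen_iff i v).2 hv, smul_add, smul_inv_smul₀ two_ne_zero]
    module
  refine ⟨hC, ?_⟩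
  rw [hC] at he
  -- For `B = -A + L` the relation with `A` says `[A, L] = -2 L`, which is degree `-1`. The relation
  -- with `As` then becomes `[C, L] = -8 A`, and `A` is the scalar `2 i - d` in degree `i`.
  obtain ⟨L, hL, hLC⟩ := he.exists_lowering hP (c := fun i => -8 * (2 * (i : K) - d))
    fun i hi => by rw [Nat.cast_sub hi]; ring
  have hAL : A * L - L * A = (-2 : K) • L := by
    refine hP.ext fun i _ v hv => ?_
    simp only [LinearMap.sub_apply, Module.End.mul_apply, LinearMap.smul_apply,
      (hP.eigen_iff i v).2 hv, map_smul]
    rcases i with _ | i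
    · have : L v = 0 := hP.ext_of_forall_proj fun j => by
        rw [hL, ← hv, hP.proj_proj_ne (by omega), map_zero, map_zero]
      simp [this]
    · rw [(hP.eigen_iff i (L v)).2 (by rw [hL, hv])]
      push_cast
      module
  have hCL : ((2 : K) • A + (2 : K) • As) * L - L * ((2 : K) • A + (2 : K) • As)
      = (-8 : K) • A := by
    refine hP.ext fun i _ v hv => ?_
    simp only [LinearMap.sub_apply, Module.End.mul_apply, hLC i v hv, LinearMap.smul_apply,
      (hP.eigen_iff i v).2 hv, smul_smul]
  have hAsL : As * L - L * As = (2 : K) • L - (4 : K) • A := by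
    have h1 : (2 : K) • (A * L - L * A) + (2 : K) • (As * L - L * As) = (-8 : K) • A := by
      rw [← hCL]
      simp only [add_mul, mul_add, smul_mul_assoc, mul_smul_comm]
      module
    rw [hAL] at h1
    have h2 : As * L - L * As = (2 : K)⁻¹ • ((2 : K) • (As * L - L * As)) := by
      rw [inv_smul_smul₀ two_ne_zero]
    rw [h2, eq_sub_of_add_eq' h1, smul_sub, smul_smul, smul_smul, smul_smul]
    norm_num
    module
  refine ⟨-A + L, ⟨?_, ?_⟩, fun X hXA hXAs => ?_⟩
  · have h1 : (-A + L) * A - A * (-A + L) = -(A * L - L * A) := by noncomm_ring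
    rw [h1, hAL]
    module
  · have h1 : As * (-A + L) - (-A + L) * As = (A * As - As * A) + (As * L - L * As) := by
      noncomm_ring
    rw [h1, hC, hAsL]
    module
  · rw [← sub_eq_zero]
    -- The difference satisfies the homogeneous relations `[g, A] = 2 g` and `[As, g] = 2 g`; hence
    -- it has degree `-1` and commutes with `C = 2 A + 2 As`.
    set g := X - (-A + L) with hg
    have h1 : g * A - A * g = (2 : K) • g := by
      have h2 : g * A - A * g = (X * A - A * X) + (A * L - L * A) := by rw [hg]; noncomm_ring
      rw [h2, hXA, hAL, hg]
      module
    have h2 : As * g - g * As = (2 : K) • g := by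
      have h3 : As * g - g * As =
          (As * X - X * As) - (A * As - As * A) - (As * L - L * As) := by rw [hg]; noncomm_ring
      rw [h3, hXAs, hAsL, hC, hg]
      module
    have hgA : ∀ i : ℕ, ∀ v, A v = (2 * (i : K) - d) • v →
        A (g v) = (2 * (i : K) - d - 2) • g v := by
      intro i v hv
      have h3 := LinearMap.congr_fun h1 v
      simp only [LinearMap.sub_apply, Module.End.mul_apply, LinearMap.smul_apply, hv,
        map_smul] at h3
      rw [sub_smul, ← h3]
      abel
    refine he.eq_zero_of_commute hP (hP.lower_of_eigen (fun v hv => ?_) fun i v hv => ?_)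
      fun v => ?_
    · refine hP.ext_of_forall_proj fun j => ?_
      have h3 := hgA 0 v hv
      have h4 := congrArg (P j) h3
      rw [← hP.apply_eq, hP.apply_proj, map_smul, ← sub_eq_zero, ← sub_smul] at h4
      rw [map_zero]
      refine (smul_eq_zero.1 h4).resolve_left fun h5 => ?_
      -- On `V_0` the vector `g v` would have eigenvalue `-d - 2`, which is none of the `2 j - d`.
      have h6 : ((j + 1 : ℕ) : K) = 0 := by
        push_cast at h5 ⊢
        linear_combination h5 / 2
      exact Nat.cast_ne_zero.2 (Nat.succ_ne_zero j) h6
    · rw [hgA (i + 1) v hv]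
      push_cast
      module
    · have h3 : ((2 : K) • A + (2 : K) • As) * g - g * ((2 : K) • A + (2 : K) • As) = 0 := by
        have h4 : ((2 : K) • A + (2 : K) • As) * g - g * ((2 : K) • A + (2 : K) • As) =
            (2 : K) • (As * g - g * As) - (2 : K) • (g * A - A * g) := by
          simp only [add_mul, mul_add, smul_mul_assoc, mul_smul_comm]
          module
        rw [h4, h1, h2, sub_self]
      exact (LinearMap.congr_fun (sub_eq_zero.1 h3) v).symm

/-- Three maps with the equitable relations define a representation of `sl₂` for which a given
equitable basis acts by these maps. -/
theorem exists_equitable_representation {X Y Z : Sl2 K} (h : IsEquitableBasis X Y Z)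
    {B A As : Module.End K V} (hBA : B * A - A * B = (2 : K) • B + (2 : K) • A)
    (hAAs : A * As - As * A = (2 : K) • A + (2 : K) • As)
    (hAsB : As * B - B * As = (2 : K) • As + (2 : K) • B) :
    ∃ ρ : Sl2 K →ₗ⁅K⁆ Module.End K V, ρ X = B ∧ ρ Y = A ∧ ρ Z = As := by
  have hrange : Set.range ![X, Y, Z] = {X, Y, Z} := by
    ext u
    simp [Matrix.range_cons, or_comm, or_left_comm, eq_comm]
  let b : Module.Basis (Fin 3) K (Sl2 K) :=
    Module.Basis.mk h.linearIndependent (by rw [hrange, h.span_eq_top])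
  let ρ : Sl2 K →ₗ[K] Module.End K V := b.constr K ![B, A, As]
  have hX : ρ X = B := by
    have : b 0 = X := by simp [b]
    rw [← this]; simp [ρ]
  have hY : ρ Y = A := by
    have : b 1 = Y := by simp [b]
    rw [← this]; simp [ρ]
  have hZ : ρ Z = As := by
    have : b 2 = Z := by simp [b]
    rw [← this]; simp [ρ]
  refine ⟨{ ρ with map_lie' := ?_ }, hX, hY, hZ⟩
  intro u w
  have hmem : ∀ u : Sl2 K, ∃ a b c : K, a • X + b • Y + c • Z = u := fun u =>
    Submodule.mem_span_triple.1 (h.span_eq_top ▸ Submodule.mem_top)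
  obtain ⟨a₁, a₂, a₃, rfl⟩ := hmem u
  obtain ⟨b₁, b₂, b₃, rfl⟩ := hmem w
  have hYX : ⁅Y, X⁆ = -((2 : K) • X + (2 : K) • Y) := by rw [← lie_skew, h.lie_X_Y]
  have hZY : ⁅Z, Y⁆ = -((2 : K) • Y + (2 : K) • Z) := by rw [← lie_skew, h.lie_Y_Z]
  have hXZ : ⁅X, Z⁆ = -((2 : K) • Z + (2 : K) • X) := by rw [← lie_skew, h.lie_Z_X]
  have h1 : ⁅B, A⁆ = (2 : K) • B + (2 : K) • A := hBA
  have h2 : ⁅A, As⁆ = (2 : K) • A + (2 : K) • As := hAAs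
  have h3 : ⁅As, B⁆ = (2 : K) • As + (2 : K) • B := hAsB
  have h4 : ⁅A, B⁆ = -((2 : K) • B + (2 : K) • A) := by rw [← lie_skew, h1]
  have h5 : ⁅As, A⁆ = -((2 : K) • A + (2 : K) • As) := by rw [← lie_skew, h2]
  have h6 : ⁅B, As⁆ = -((2 : K) • As + (2 : K) • B) := by rw [← lie_skew, h3]
  change ρ _ = ⁅ρ _, ρ _⁆
  simp only [map_add, map_smul, map_neg, lie_add, add_lie, lie_smul, smul_lie, lie_self, map_zero, hX,
    hY,
    hZ, h.lie_X_Y, h.lie_Y_Z, h.lie_Z_X, hYX, hZY, hXZ, h1, h2, h3, h4, h5, h6]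

/-- The entries of an element `!![a, b; c, -a]` of an equitable pair satisfy `a² + b c = 1`. -/
theorem IsEquitablePair.exists_entries [CharZero K] {Y Z : Sl2 K} (h : IsEquitablePair Y Z) :
    ∃ a b c : K, (Y : Matrix (Fin 2) (Fin 2) K) = !![a, b; c, -a] ∧ a ^ 2 + b * c = 1 := by
  obtain ⟨X, hX⟩ := h
  have htr : ∀ u : Sl2 K, ∃ a b c : K, (u : Matrix (Fin 2) (Fin 2) K) = !![a, b; c, -a] := by
    intro u
    have h1 : Matrix.trace (u : Matrix (Fin 2) (Fin 2) K) = 0 := u.2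
    rw [Matrix.trace_fin_two] at h1
    refine ⟨u.1 0 0, u.1 0 1, u.1 1 0, ?_⟩
    rw [← eq_neg_of_add_eq_zero_right h1]
    exact Matrix.eta_fin_two _
  obtain ⟨a, b, c, hY⟩ := htr Y
  obtain ⟨n, m, l, hN⟩ := htr (Y + Z)
  refine ⟨a, b, c, hY, ?_⟩
  -- `Y + Z` is a nonzero eigenvector of `ad Y` for the eigenvalue `2`. This forces `Y` to have
  -- eigenvalues `1` and `-1`, that is, determinant `-1`.
  have hYN : ⁅Y, Y + Z⁆ = (2 : K) • (Y + Z) := by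
    rw [lie_add, lie_self, zero_add, hX.lie_Y_Z, smul_add]
  have h1 := congrArg (fun u : Sl2 K => (u : Matrix (Fin 2) (Fin 2) K)) hYN
  simp only [LieAlgebra.SpecialLinear.sl_bracket, SetLike.val_smul, hN, hY] at h1
  have e00 := congrFun (congrFun h1 0) 0
  have e01 := congrFun (congrFun h1 0) 1
  have e10 := congrFun (congrFun h1 1) 0
  simp at e00 e01 e10
  have hne : ¬ (n = 0 ∧ m = 0 ∧ l = 0) := by
    rintro ⟨rfl, rfl, rfl⟩
    have h0 : Y + Z = 0 := by
      apply Subtype.ext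
      rw [hN]
      ext i j
      fin_cases i <;> fin_cases j <;> simp
    have h2 := Fintype.linearIndependent_iff.1 hX.linearIndependent ![0, 1, 1]
      (by simpa [Fin.sum_univ_three] using h0) 1
    simp at h2
  have e1 : (a - 1) * m = b * n := by linear_combination e01 / 2
  have e2 : (a + 1) * l = c * n := by linear_combination -e10 / 2
  have e3 : b * l - c * m = 2 * n := by linear_combination e00
  by_cases hn : n = 0
  · subst hn
    by_cases hm : m = 0
    · subst hm
      have hl : l ≠ 0 := fun hl => hne ⟨rfl, rfl, hl⟩
      have ha : a + 1 = 0 := (mul_eq_zero.1 (e2.trans (mul_zero c))).resolve_right hl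
      have hb : b = 0 := (mul_eq_zero.1 (by linear_combination e3 : b * l = 0)).resolve_right hl
      rw [hb]
      linear_combination (a - 1) * ha
    · have ha : a - 1 = 0 := (mul_eq_zero.1 (e1.trans (mul_zero b))).resolve_right hm
      have hl : l = 0 := by linear_combination e2 / 2 - ha * l / 2
      have hc : c = 0 :=
        (mul_eq_zero.1 (by rw [hl] at e3; linear_combination -e3 : c * m = 0)).resolve_right hm
      rw [hc]
      linear_combination (a + 1) * ha
  · have h2 : 2 * n * (a ^ 2 + b * c - 1) = 0 := by
      linear_combination (-(a ^ 2 - 1)) * e3 + (a - 1) * b * e2 - (a + 1) * c * e1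
    have h3 := (mul_eq_zero.1 h2).resolve_left (mul_ne_zero two_ne_zero hn)
    linear_combination h3

/-- Passage from `Y` to `h` through an intermediate `M`: both `M - Y` for `ad Y` and `M - h` for `ad
(-M)` are eigenvectors with eigenvalue `2`, and adding such an eigenvector preserves the spectrum.
-/
theorem span_eigen_sl2H_eq_top [CharZero K] [LieRingModule (Sl2 K) V] [LieModule K (Sl2 K) V]
    {a b c : K} (habc : a ^ 2 + b * c = 1) (ha : a + 1 ≠ 0) {Y : Sl2 K}
    (hY : (Y : Matrix (Fin 2) (Fin 2) K) = !![a, b; c, -a]) {d : ℕ}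
    (h : Submodule.span K {v : V | ∃ i ≤ d,
      LieModule.toEnd K (Sl2 K) V Y v = (2 * (i : K) - d) • v} = ⊤) :
    Submodule.span K {v : V | ∃ i ≤ d,
      LieModule.toEnd K (Sl2 K) V (sl2H K) v = (2 * (i : K) - d) • v} = ⊤ := by
  -- `M` has eigenvalue `1` on the vector `(a + 1, c)`, as `Y` does, and eigenvalue `-1` on `(0,
  -- 1)`, as `h` does. The condition `a + 1 ≠ 0` makes these lines distinct.
  let M : Sl2 K := ⟨!![1, 0; 2 * c / (a + 1), -1], by
    simp [LieAlgebra.SpecialLinear.sl, Matrix.trace_fin_two]⟩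
  have hc : 2 * c / (a + 1) * (a + 1) = 2 * c := div_mul_cancel₀ _ ha
  have hend : ∀ {u w : Sl2 K}, ⁅u, w⁆ = (2 : K) • w →
      LieModule.toEnd K (Sl2 K) V u * LieModule.toEnd K (Sl2 K) V w -
        LieModule.toEnd K (Sl2 K) V w * LieModule.toEnd K (Sl2 K) V u =
        (2 : K) • LieModule.toEnd K (Sl2 K) V w := by
    intro u w huw
    rw [← Ring.lie_def, ← LieHom.map_lie, huw, map_smul]
  have h1 : ⁅Y, M - Y⁆ = (2 : K) • (M - Y) := by
    apply Subtype.ext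
    simp only [LieAlgebra.SpecialLinear.sl_bracket, SetLike.val_smul, hY, M,
      AddSubgroupClass.coe_sub]
    have h2 : 2 * c / (a + 1) * b = 2 * (1 - a) := by
      refine mul_right_cancel₀ ha ?_
      linear_combination b * hc + 2 * habc
    ext i j
    fin_cases i <;> fin_cases j <;> simp
    · linear_combination h2
    · ring
    · linear_combination -2 * hc
    · linear_combination -h2
  have h2 : ⁅-M, M - sl2H K⁆ = (2 : K) • (M - sl2H K) := by
    apply Subtype.ext
    simp only [LieAlgebra.SpecialLinear.sl_bracket, SetLike.val_smul, M, sl2H,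
      AddSubgroupClass.coe_sub, NegMemClass.coe_neg]
    ext i j
    fin_cases i <;> fin_cases j <;> simp
    ring
  have h3 := span_eigen_add_eq_top h (hend h1)
  rw [← map_add, add_sub_cancel] at h3
  have h4 := span_eigen_neg_eq_top h3
  rw [← map_neg] at h4
  have h5 := span_eigen_neg_eq_top (span_eigen_add_eq_top h4 (hend h2))
  rw [← map_add, ← map_neg] at h5
  rwa [show -(-M + (M - sl2H K)) = sl2H K by abel] at h5

theorem isSl2Segregated_of_equitable [CharZero K] [LieRingModule (Sl2 K) V]
    [LieModule K (Sl2 K) V] {Y Z : Sl2 K} (hYZ : IsEquitablePair Y Z) {d : ℕ}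
    (h : Submodule.span K {v : V | ∃ i ≤ d,
      LieModule.toEnd K (Sl2 K) V Y v = (2 * (i : K) - d) • v} = ⊤) :
    IsSl2Segregated K V := by
  have key : Submodule.span K {v : V | ∃ i ≤ d,
      LieModule.toEnd K (Sl2 K) V (sl2H K) v = (2 * (i : K) - d) • v} = ⊤ := by
    obtain ⟨a, b, c, hY, habc⟩ := hYZ.exists_entries
    -- In the excluded case `-Y` serves instead: its upper left entry is `1`, and the list of
    -- eigenvalues is symmetric under negation.
    by_cases ha : a + 1 = 0
    · have h1 := span_eigen_neg_eq_top h
      rw [← map_neg] at h1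
      refine span_eigen_sl2H_eq_top (a := -a) (b := -b) (c := -c) ?_ ?_ ?_ h1
      · linear_combination habc
      · rw [eq_neg_of_add_eq_zero_left ha]; norm_num
      · rw [NegMemClass.coe_neg, hY]
        ext i j
        fin_cases i <;> fin_cases j <;> simp
    · exact span_eigen_sl2H_eq_top habc ha hY h
  rcases Nat.even_or_odd d with hd | hd
  · refine Or.inl (eq_top_iff.2 (key ▸ Submodule.span_mono ?_))
    rintro v ⟨i, -, hv⟩
    exact ⟨2 * i - d, (even_two_mul (i : ℤ)).sub (by exact_mod_cast hd), by
      rw [← LieModule.toEnd_apply_apply K, hv]; push_cast; rfl⟩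
  · refine Or.inr (eq_top_iff.2 (key ▸ Submodule.span_mono ?_))
    rintro v ⟨i, -, hv⟩
    exact ⟨2 * i - d, (even_two_mul (i : ℤ)).sub_odd (by exact_mod_cast hd), by
      rw [← LieModule.toEnd_apply_apply K, hv]; push_cast; rfl⟩

end LieCase

/-! ### Base `q⁻²`: the action of the equitable generators. -/

section QuantumCase

variable {K V : Type*} [Field K] [AddCommGroup V] [Module K V]

/-- For a reduced pair with base `q⁻²`, the map by which the generator `x` of an equitable
presentation has to act. -/
theorem exists_quantum_equitable_third [CharZero K] [FiniteDimensional K V]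
    {A As : Module.End K V} {d : ℕ} {P : ℕ → Module.End K V} {q : K} {θ : ℕ → K}
    (hq : q ≠ 0) (hq2 : 1 - q ^ 2 ≠ 0) (hθ0 : ∀ i, θ i ≠ 0)
    (hstep : ∀ i, θ i = q ^ 2 * θ (i + 1)) (hsymm : ∀ i ≤ d, θ (d - i) = (θ i)⁻¹)
    (hfirst : ∀ j, θ j ≠ q ^ 2 * θ 0)
    (hP : IsEigengrading A d θ P) (he : IsLefschetz d P (A * As - As * A))
    (hAs : ∀ i v, P i v = v →
      As v = (θ i)⁻¹ • v + (θ (i + 1) - θ i)⁻¹ • (A * As - As * A) v) :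
    q • (A * As) - q⁻¹ • (As * A) = (q - q⁻¹) • (1 : Module.End K V) ∧
    ∃ B : Module.End K V,
      (q • (B * A) - q⁻¹ • (A * B) = (q - q⁻¹) • (1 : Module.End K V) ∧
      q • (As * B) - q⁻¹ • (B * As) = (q - q⁻¹) • (1 : Module.End K V)) ∧
      aeval B (Lagrange.nodal (range (d + 1)) fun i => (θ i)⁻¹) = 0 ∧
      ∀ X : Module.End K V, q • (X * A) - q⁻¹ • (A * X) = (q - q⁻¹) • (1 : Module.End K V) →
        q • (As * X) - q⁻¹ • (X * As) = (q - q⁻¹) • (1 : Module.End K V) → X = B := by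
  set C := A * As - As * A with hC
  have hA : ∀ i v, P i v = v → A v = θ i • v := fun i v => (hP.eigen_iff i v).2
  have hPC : ∀ i v, P i v = v → P (i + 1) (C v) = C v := fun i v hv => by rw [he.proj_raise, hv]
  have hAs' : ∀ i v, P i v = v → As v = (q ^ 2 * θ (i + 1))⁻¹ • v +
      (θ (i + 1) * (1 - q ^ 2))⁻¹ • C v := by
    intro i v hv
    rw [hAs i v hv, hstep i]
    congr 3
    ring
  constructor
  · refine hP.ext fun i _ v hv => ?_
    simp only [LinearMap.sub_apply, LinearMap.smul_apply, Module.End.mul_apply,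
      Module.End.one_apply, hA i v hv, map_smul, hAs' i v hv, map_add, hA _ _ (hPC i v hv)]
    rw [hstep i]
    have := hθ0 (i + 1)
    match_scalars <;> field_simp
    ring
  -- The scalars are the only choice for which the degree `0` part of `q As B - q⁻¹ B As = q - q⁻¹`
  -- holds with `B = A⁻¹ + L`. They are antisymmetric since `θ (d - i) = (θ i)⁻¹`.
  obtain ⟨L, hL, hLC⟩ := he.exists_lowering hP
    (c := fun i => q * (q - q⁻¹) * (q⁻¹ ^ 2 - 1) * (θ i - (θ i)⁻¹))
    fun i hi => by rw [hsymm i hi, inv_inv]; ring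
  have hL0 : ∀ v, P 0 v = v → L v = 0 := fun v hv => hP.ext_of_forall_proj fun j => by
    rw [hL, ← hv, hP.proj_proj_ne (by omega), map_zero, map_zero]
  have hPL : ∀ i v, P (i + 1) v = v → P i (L v) = L v := fun i v hv => by rw [hL, hv]
  have hAL : ∀ i v, P i v = v → A (L v) = (q ^ 2 * θ i) • L v := by
    intro i v hv
    rcases i with _ | i
    · simp [hL0 v hv]
    · rw [hA i _ (hPL i v hv), hstep i]
  have hAsL : ∀ i v, P i v = v → As (L v) = (q ^ 2 * (q ^ 2 * θ (i + 1)))⁻¹ • L v +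
      (q ^ 2 * θ (i + 1) * (1 - q ^ 2))⁻¹ • C (L v) := by
    intro i v hv
    rcases i with _ | i
    · simp [hL0 v hv]
    · rw [hAs' i _ (hPL i v hv), hstep (i + 1)]
  -- This is the inverse of `A`.
  let D : Module.End K V := ∑ i ∈ range (d + 1), (θ i)⁻¹ • P i
  have hD : ∀ i v, P i v = v → D v = (θ i)⁻¹ • v := by
    intro i v hv
    by_cases hi : i ≤ d
    · simp only [D, LinearMap.sum_apply, LinearMap.smul_apply]
      rw [sum_eq_single i, hv]
      · intro j _ hj
        rw [← hv, hP.proj_proj_ne hj, smul_zero]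
      · intro h; simp at h; omega
    · rw [← hv, hP.proj_eq_zero i (by omega)]
      simp
  have hB : ∀ i v, P i v = v → (D + L) v = (θ i)⁻¹ • v + L v := fun i v hv => by
    rw [LinearMap.add_apply, hD i v hv]
  have hBA : q • ((D + L) * A) - q⁻¹ • (A * (D + L)) = (q - q⁻¹) • (1 : Module.End K V) := by
    refine hP.ext fun i _ v hv => ?_
    simp only [LinearMap.sub_apply, LinearMap.smul_apply, Module.End.mul_apply,
      Module.End.one_apply, hA i v hv, map_smul, hB i v hv, map_add, hAL i v hv]
    have := hθ0 i
    match_scalars <;> field_simp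
    ring
  have hAsB : q • (As * (D + L)) - q⁻¹ • ((D + L) * As) = (q - q⁻¹) • (1 : Module.End K V) := by
    refine hP.ext fun i _ v hv => ?_
    have hLCv : L (C v) = C (L v) - (q * (q - q⁻¹) * (q⁻¹ ^ 2 - 1) * (θ i - (θ i)⁻¹)) • v := by
      rw [← hLC i v hv]
      abel
    simp only [LinearMap.sub_apply, LinearMap.smul_apply, Module.End.mul_apply,
      Module.End.one_apply, hB i v hv, map_add, map_smul, hAs' i v hv, hAsL i v hv,
      hB _ _ (hPC i v hv), hLCv, hstep i]
    have := hθ0 (i + 1)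
    match_scalars <;> field_simp <;> ring
  refine ⟨D + L, ⟨hBA, hAsB⟩, hP.aeval_nodal_of_lower hB hL, fun X hXA hXAs => ?_⟩
  rw [← sub_eq_zero]
  set g := X - (D + L) with hg
  have h1 : q • (g * A) - q⁻¹ • (A * g) = 0 := by
    have h2 : q • (g * A) - q⁻¹ • (A * g) = (q • (X * A) - q⁻¹ • (A * X)) -
        (q • ((D + L) * A) - q⁻¹ • (A * (D + L))) := by
      rw [hg, sub_mul, mul_sub]; module
    rw [h2, hXA, hBA, sub_self]
  have h2 : q • (As * g) - q⁻¹ • (g * As) = 0 := by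
    have h3 : q • (As * g) - q⁻¹ • (g * As) = (q • (As * X) - q⁻¹ • (X * As)) -
        (q • (As * (D + L)) - q⁻¹ • ((D + L) * As)) := by
      rw [hg, sub_mul, mul_sub]; module
    rw [h3, hXAs, hAsB, sub_self]
  -- The first homogeneous relation says that `g` multiplies eigenvalues of `A` by `q ^ 2`, so `g`
  -- has degree `-1`; `hfirst` excludes a nonzero image of `V_0`.
  have h3 : A * g = q ^ 2 • (g * A) := by
    rw [← smul_inv_smul₀ hq (A * g), ← sub_eq_zero.1 h1, smul_smul, sq]
  have h4 : g * As = q ^ 2 • (As * g) := by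
    rw [← smul_inv_smul₀ hq (g * As), ← sub_eq_zero.1 h2, smul_smul, sq]
  have hgA : ∀ i v, A v = θ i • v → A (g v) = (q ^ 2 * θ i) • g v := by
    intro i v hv
    have h5 := LinearMap.congr_fun h3 v
    simpa [Module.End.mul_apply, hv, smul_smul] using h5
  clear_value g
  refine he.eq_zero_of_commute hP (hP.lower_of_eigen (fun v hv => ?_) fun i v hv => ?_)
    fun v => ?_
  · refine hP.ext_of_forall_proj fun j => ?_
    have h5 := congrArg (P j) (hgA 0 v hv)
    rw [← hP.apply_eq, hP.apply_proj, map_smul, ← sub_eq_zero, ← sub_smul] at h5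
    rw [map_zero]
    exact (smul_eq_zero.1 h5).resolve_left (sub_ne_zero.2 (hfirst j))
  · rw [hgA (i + 1) v hv, ← hstep]
  · have h5 : q ^ 2 • (g * C) = q ^ 2 • (C * g) := by
      have e1 : q ^ 2 • (g * (A * As)) = q ^ 2 • (A * As * g) := by
        rw [← mul_assoc, ← smul_mul_assoc, ← h3, mul_assoc, h4, mul_smul_comm, ← mul_assoc]
      have e2 : q ^ 2 • (g * (As * A)) = q ^ 2 • (As * A * g) := by
        rw [mul_assoc As, h3, ← mul_assoc g, h4, smul_mul_assoc, mul_smul_comm, mul_assoc]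
      rw [hC, mul_sub, sub_mul, smul_sub, smul_sub, e1, e2]
    exact LinearMap.congr_fun (smul_right_injective _ (pow_ne_zero 2 hq) h5) v

/-- `0` is not a root of an annihilating polynomial, so `B` has trivial kernel. -/
theorem isUnit_of_aeval_nodal_eq_zero [FiniteDimensional K V] {B : Module.End K V} {n : ℕ}
    {μ : ℕ → K} (hμ : ∀ i, μ i ≠ 0) (h : aeval B (Lagrange.nodal (range n) μ) = 0) :
    IsUnit B := by
  rw [LinearMap.isUnit_iff_ker_eq_bot]
  refine eq_bot_iff.2 fun v hv => ?_
  have h1 : B v = (0 : K) • v := by rw [zero_smul]; exact hv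
  have h2 := Module.End.aeval_apply_of_mem_apply_eq_smul (p := Lagrange.nodal (range n) μ) h1
  rw [h, LinearMap.zero_apply] at h2
  exact (smul_eq_zero.1 h2.symm).resolve_left
    (Lagrange.eval_nodal_not_at_node fun i _ => (hμ i).symm)

variable {q : K}

theorem inv_smul_eq_one_iff {R : Type*} [Ring R] [Algebra K R] (hq : q - q⁻¹ ≠ 0) {a b : R} :
    (q - q⁻¹)⁻¹ • (q • a - q⁻¹ • b) = 1 ↔ q • a - q⁻¹ • b = (q - q⁻¹) • (1 : R) := by
  rw [inv_smul_eq_iff₀ hq]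

/-- An algebra homomorphism from the equitable presentation. -/
theorem exists_eqUq_hom {R : Type*} [Ring R] [Algebra K R] (hq : q - q⁻¹ ≠ 0) {x xi y z : R}
    (hx : x * xi = 1) (hx' : xi * x = 1)
    (hxy : q • (x * y) - q⁻¹ • (y * x) = (q - q⁻¹) • (1 : R))
    (hyz : q • (y * z) - q⁻¹ • (z * y) = (q - q⁻¹) • (1 : R))
    (hzx : q • (z * x) - q⁻¹ • (x * z) = (q - q⁻¹) • (1 : R)) :
    ∃ φ : EqUq K q →ₐ[K] R, φ (eqGen K q .y) = y ∧ φ (eqGen K q .z) = z := by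
  let F : EqGen → R := fun g => match g with
    | .x => x
    | .xinv => xi
    | .y => y
    | .z => z
  have hF : ∀ ⦃a b : FreeAlgebra K EqGen⦄, EqRel K q a b →
      FreeAlgebra.lift K F a = FreeAlgebra.lift K F b := by
    intro a b hab
    cases hab <;>
      simp only [map_smul, map_sub, map_mul, map_one, FreeAlgebra.lift_ι_apply, F,
        inv_smul_smul₀ hq, hx, hx', hxy, hyz, hzx]
  refine ⟨RingQuot.liftAlgHom K ⟨FreeAlgebra.lift K F, hF⟩, ?_, ?_⟩ <;>
    simp [eqGen, F]

theorem IsEquitableGenerators.relations {R : Type*} [Ring R] [Algebra K R] (hq : q - q⁻¹ ≠ 0)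
    {x xinv y z : Uq K q} (h : IsEquitableGenerators x xinv y z) (φ : Uq K q →ₐ[K] R) :
    φ x * φ xinv = 1 ∧ φ xinv * φ x = 1 ∧
    q • (φ x * φ y) - q⁻¹ • (φ y * φ x) = (q - q⁻¹) • (1 : R) ∧
    q • (φ z * φ x) - q⁻¹ • (φ x * φ z) = (q - q⁻¹) • (1 : R) := by
  obtain ⟨ψ, rfl, rfl, rfl, rfl⟩ := h
  let Φ : FreeAlgebra K EqGen →ₐ[K] R :=
    (φ.comp ψ.toAlgHom).comp (RingQuot.mkAlgHom K (EqRel K q))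
  have hrel : ∀ {a b : FreeAlgebra K EqGen}, EqRel K q a b → Φ a = Φ b :=
    fun hab => congrArg (fun u => φ (ψ u)) (RingQuot.mkAlgHom_rel K hab)
  have hgen : ∀ g, φ (ψ (eqGen K q g)) = Φ (FreeAlgebra.ι K g) := fun g => rfl
  simp only [hgen]
  refine ⟨?_, ?_, (inv_smul_eq_one_iff hq).1 ?_, (inv_smul_eq_one_iff hq).1 ?_⟩
  · simpa only [map_mul, map_one] using hrel .x_xinv
  · simpa only [map_mul, map_one] using hrel .xinv_x
  · simpa only [map_smul, map_sub, map_mul, map_one] using hrel .x_y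
  · simpa only [map_smul, map_sub, map_mul, map_one] using hrel .z_x

end QuantumCase

/-! ### Construction and uniqueness of the module structures. -/

section Actions

attribute [local instance] LieRing.ofAssociativeRing

variable {K V : Type*} [Field K] [CharZero K] [AddCommGroup V] [Module K V]
  [FiniteDimensional K V] {A As : Module.End K V} {d : ℕ}

theorem exists_sl2_action (hpair : IsBidiagonalPair A As)
    (h : IsEigenvalueSequence A As d fun i => 2 * (i : K) - (d : K))
    (hs : IsEigenvalueSequence As A d fun i => (d : K) - 2 * (i : K)) :
    ∃ B : Module.End K V, ∀ Y Z : Sl2 K, IsEquitablePair Y Z →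
      (∃ (_ : LieRingModule (Sl2 K) V) (_ : LieModule K (Sl2 K) V),
        (∀ v : V, ⁅Y, v⁆ = A v) ∧ ∀ v : V, ⁅Z, v⁆ = As v) ∧
      ∀ (_ : LieRingModule (Sl2 K) V) (_ : LieModule K (Sl2 K) V),
        (∀ v : V, ⁅Y, v⁆ = A v) → (∀ v : V, ⁅Z, v⁆ = As v) →
          (∀ X : Sl2 K, IsEquitableBasis X Y Z → ∀ v : V, ⁅X, v⁆ = B v) ∧
          IsSl2Segregated K V := by
  obtain ⟨P, hP, he, hAs⟩ := hpair.exists_isLefschetz h hs (arithmetic_injective d)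
    fun i j hij => by simpa using hij
  obtain ⟨hAAs, B, ⟨hBA, hAsB⟩, huniq⟩ := exists_equitable_third hP he fun i v hv => by
    have h2 : 2 * ((i + 1 : ℕ) : K) - d - (2 * (i : K) - d) = 2 := by push_cast; ring
    rw [hAs i v hv, h2]
  refine ⟨B, fun Y Z hYZ => ⟨?_, fun _ _ hY hZ => ⟨fun X hX => ?_, ?_⟩⟩⟩
  · obtain ⟨X, hX⟩ := hYZ
    obtain ⟨ρ, -, hY, hZ⟩ := exists_equitable_representation hX hBA hAAs hAsB
    exact ⟨LieRingModule.compLieHom V ρ, LieModule.compLieHom V ρ,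
      fun v => LinearMap.congr_fun hY v, fun v => LinearMap.congr_fun hZ v⟩
  · let ρ := LieModule.toEnd K (Sl2 K) V
    have hY' : ρ Y = A := LinearMap.ext hY
    have hZ' : ρ Z = As := LinearMap.ext hZ
    have hXB : ρ X = B := by
      refine huniq (ρ X) ?_ ?_
      · have h1 := congrArg ρ hX.lie_X_Y
        rwa [LieHom.map_lie, map_add, map_smul, map_smul, hY', Ring.lie_def] at h1
      · have h1 := congrArg ρ hX.lie_Z_X
        rwa [LieHom.map_lie, map_add, map_smul, map_smul, hZ', Ring.lie_def] at h1
    exact fun v => LinearMap.congr_fun hXB v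
  · refine isSl2Segregated_of_equitable hYZ (d := d) ?_
    rw [show LieModule.toEnd K (Sl2 K) V Y = A from LinearMap.ext hY]
    exact hP.span_eq_top

theorem exists_uq_action {q : K} (hpair : IsBidiagonalPair A As) (hq0 : q ≠ 0)
    (hq : ∀ n : ℕ, 0 < n → q ^ n ≠ 1)
    (h : IsEigenvalueSequence A As d fun i => q ^ ((d : ℤ) - 2 * (i : ℤ)))
    (hs : IsEigenvalueSequence As A d fun i => q ^ (2 * (i : ℤ) - (d : ℤ))) :
    ∃ B Binv : Module.End K V, ∀ y z : Uq K q, IsUqEquitablePair y z →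
      (∃ (_ : Module (Uq K q) V) (_ : IsScalarTower K (Uq K q) V),
        (∀ v : V, y • v = A v) ∧ ∀ v : V, z • v = As v) ∧
      ∀ (_ : Module (Uq K q) V) (_ : IsScalarTower K (Uq K q) V),
        (∀ v : V, y • v = A v) → (∀ v : V, z • v = As v) →
          ∀ x xinv : Uq K q, IsEquitableGenerators x xinv y z →
            (∀ v : V, x • v = B v) ∧ (∀ v : V, xinv • v = Binv v) ∧
            (x = uqK K q → IsUqSegregated K q V) := by
  -- As `q` is not a root of unity, both eigenvalue sequences stay injective when continued beyond
  -- `d`, as eigengradings require.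
  have hinj : Function.Injective fun n : ℤ => q ^ n := by
    have key : ∀ m n : ℤ, m < n → q ^ m ≠ q ^ n := by
      intro m n hmn heq
      refine hq (n - m).toNat (by omega) ?_
      rw [← zpow_natCast, Int.toNat_of_nonneg (by omega), zpow_sub₀ hq0, ← heq,
        div_self (zpow_ne_zero _ hq0)]
    intro m n hmn
    rcases lt_trichotomy m n with h1 | h1 | h1
    · exact absurd hmn (key m n h1)
    · exact h1
    · exact absurd hmn.symm (key n m h1)
  have hsub : q - q⁻¹ ≠ 0 := fun h0 => by
    have h1 : (1 : ℤ) = -1 := hinj (by simpa using sub_eq_zero.1 h0)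
    omega
  have hq2 : 1 - q ^ 2 ≠ 0 := fun h0 => hq 2 two_pos (sub_eq_zero.1 h0).symm
  have hθs : Function.Injective fun i : ℕ => q ^ (2 * (i : ℤ) - (d : ℤ)) := fun i j hij => by
    have := hinj hij
    omega
  have hinv : ∀ i : ℕ, (q ^ ((d : ℤ) - 2 * (i : ℤ)))⁻¹ = q ^ (2 * (i : ℤ) - (d : ℤ)) := fun i => by
    rw [← zpow_neg, neg_sub]
  obtain ⟨P, hP, he, hAs⟩ := hpair.exists_isLefschetz h hs
    (fun i j hij => by have := hinj hij; omega) hθs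
  obtain ⟨hAAs, B, ⟨hBA, hAsB⟩, hnod, huniq⟩ := exists_quantum_equitable_third hq0 hq2
    (fun i => zpow_ne_zero _ hq0)
    (fun i => by
      rw [← zpow_natCast q 2, ← zpow_add₀ hq0]
      congr 1
      push_cast
      ring)
    (fun i hi => by
      rw [hinv]
      congr 1
      omega)
    (fun j hj => by
      rw [← zpow_natCast q 2, ← zpow_add₀ hq0] at hj
      have := hinj hj
      omega)
    hP he (fun i v hv => by rw [hAs i v hv, hinv])
  have hBunit : IsUnit B :=
    isUnit_of_aeval_nodal_eq_zero (fun i => inv_ne_zero (zpow_ne_zero _ hq0)) hnod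
  -- `B` is diagonalizable with eigenvalues `q ^ (2 i - d)`, whose exponents all have the parity of
  -- `d`; when `x = k` this is segregation.
  obtain ⟨Q, hQ⟩ := exists_isEigengrading (θ := fun i : ℕ => q ^ (2 * (i : ℤ) - (d : ℤ))) hθs
    (by simpa only [hinv] using hnod)
  obtain ⟨u, rfl⟩ := hBunit
  refine ⟨u, ↑u⁻¹, fun y z hyz => ⟨?_, fun _ _ hy hz x xinv hx => ?_⟩⟩
  · obtain ⟨x, xinv, ψ, -, -, rfl, rfl⟩ := hyz
    obtain ⟨φ, hφy, hφz⟩ := exists_eqUq_hom hsub u.mul_inv u.inv_mul hBA hAAs hAsB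
    let Φ : Uq K q →ₐ[K] Module.End K V := φ.comp ψ.symm.toAlgHom
    have hΦ : ∀ g, Φ (ψ (eqGen K q g)) = φ (eqGen K q g) := fun g =>
      congrArg φ (ψ.symm_apply_apply _)
    let _ : Module (Uq K q) V := Module.compHom V Φ.toRingHom
    have hsmul : ∀ (a : Uq K q) (v : V), a • v = Φ a v := fun _ _ => rfl
    refine ⟨inferInstance, ⟨fun c a v => ?_⟩, fun v => ?_, fun v => ?_⟩
    · rw [hsmul, hsmul, map_smul, LinearMap.smul_apply]
    · rw [hsmul, hΦ, hφy]
    · rw [hsmul, hΦ, hφz]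
  · let φ : Uq K q →ₐ[K] Module.End K V := Algebra.lsmul K K V
    have hφ : ∀ (a : Uq K q) (v : V), φ a v = a • v := fun _ _ => rfl
    have hφy : φ y = A := LinearMap.ext hy
    have hφz : φ z = As := LinearMap.ext hz
    obtain ⟨h1, h2, h3, h4⟩ := hx.relations hsub φ
    rw [hφy] at h3
    rw [hφz] at h4
    have hxB : φ x = u := huniq _ h3 h4
    have hxinv : φ xinv = ↑u⁻¹ := by
      rw [hxB] at h1
      exact (Units.inv_eq_of_mul_eq_one_right h1).symm
    refine ⟨fun v => LinearMap.congr_fun hxB v, fun v => LinearMap.congr_fun hxinv v,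
      fun hxk => ?_⟩
    have hk : ∀ v, uqK K q • v = (u : Module.End K V) v := fun v => by
      rw [← hxk, ← hφ, hxB]
    have hspan := hQ.span_eq_top
    rcases Nat.even_or_odd d with hd | hd
    · refine Or.inl (eq_top_iff.2 (hspan ▸ Submodule.span_mono ?_))
      rintro v ⟨i, -, hv⟩
      exact ⟨2 * i - d, (even_two_mul (i : ℤ)).sub (by exact_mod_cast hd), by rw [hk, hv]⟩
    · refine Or.inr (eq_top_iff.2 (hspan ▸ Submodule.span_mono ?_))
      rintro v ⟨i, -, hv⟩
      exact ⟨2 * i - d, (even_two_mul (i : ℤ)).sub_odd (by exact_mod_cast hd), by rw [hk, hv]⟩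

end Actions

end BidiagonalPair

open BidiagonalPair in
theorem theorem5p9 {K : Type*} [Field K] [IsAlgClosed K] [CharZero K]
    {V : Type*} [AddCommGroup V] [Module K V] [FiniteDimensional K V] [Nontrivial V]
    (A As : Module.End K V) (hpair : IsBidiagonalPair A As) (hred : IsReduced A As) :
    (base A As = 1 →
      ∃ B : Module.End K V, ∀ Y Z : Sl2 K, IsEquitablePair Y Z →
        (∃ (_ : LieRingModule (Sl2 K) V) (_ : LieModule K (Sl2 K) V),
          (∀ v : V, ⁅Y, v⁆ = A v) ∧ ∀ v : V, ⁅Z, v⁆ = As v) ∧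
        ∀ (_ : LieRingModule (Sl2 K) V) (_ : LieModule K (Sl2 K) V),
          (∀ v : V, ⁅Y, v⁆ = A v) → (∀ v : V, ⁅Z, v⁆ = As v) →
            (∀ X : Sl2 K, IsEquitableBasis X Y Z → ∀ v : V, ⁅X, v⁆ = B v) ∧
            IsSl2Segregated K V) ∧
    (base A As ≠ 1 →
      ∀ q : K, IsReducedWith A As q → (∀ n : ℕ, 0 < n → q ^ n ≠ 1) →
      ∃ B Binv : Module.End K V, ∀ y z : Uq K q, IsUqEquitablePair y z →
        (∃ (_ : Module (Uq K q) V) (_ : IsScalarTower K (Uq K q) V),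
          (∀ v : V, y • v = A v) ∧ ∀ v : V, z • v = As v) ∧
        ∀ (_ : Module (Uq K q) V) (_ : IsScalarTower K (Uq K q) V),
          (∀ v : V, y • v = A v) → (∀ v : V, z • v = As v) →
            ∀ x xinv : Uq K q, IsEquitableGenerators x xinv y z →
              (∀ v : V, x • v = B v) ∧ (∀ v : V, xinv • v = Binv v) ∧
              (x = uqK K q → IsUqSegregated K q V)) := by
  constructor
  · intro hb
    -- Reducedness of the second kind includes that the base is not `1`.
    obtain ⟨-, h, hs⟩ : IsReducedOne A As := hred.resolve_right fun ⟨q, hq⟩ => hq.1 hb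
    exact exists_sl2_action hpair h hs
  · rintro - q ⟨-, hq0, -, h, hs⟩ hq
    exact exists_uq_action hpair hq0 hq h hs
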